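/- For a nondegenerate closed triangle $\Delta\subset\mathbb R^2$ with vertex set $\{A,B,C\}$, edge lengths $a,b,c$ and circumradius $R$, define its Voronoi functional by $$V(\Delta)=\int_{\Delta}\min_{v\in\{A,B,C\}}\|x-v\|^2\,dx\ \text{ if }\Delta\text{ is acute},\qquad V(\Delta)=\tfrac{\mathrm{area}(\Delta)}{12}\,(a^2+b^2+c^2-4R^2)\ \text{ otherwise}.$$ A vertex $v$ of $\Delta$ is visible from $x\in\mathbb R^2$ if the segment from $x$ to $v$ meets $\Delta$ only in $v$. Let $g_\Delta(x)$ be the squared distance from $x$ to the nearest vertex of $\Delta$ minus the squared distance from $x$ to the nearest visible vertex of $\Delta$, where the second term is $0$ if no vertex is visible. For a finite family $T$ of triangles put $V(T)=\sum_{\Delta\in T}V(\Delta)$ and $g_T(x)=\sum_{\Delta\in T}g_\Delta(x)$; for a simplicial complex the sums range over its triangles. Voronoi Optimality Theorem. Let $S\subset\mathbb R^2$ be a finite set in general position, meaning that no four points of $S$ lie on a common circle. Let $D$ be the Delaunay triangulation of $S$, consisting of all nondegenerate triangles spanned by three points of $S$ whose circumcircle encloses no point of $S$. Let $K$ be a geometric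 triangulation of $S$, that is, a simplicial complex in $\mathbb R^2$ with vertex set $S$ and underlying space $\mathrm{conv}(S)$. Then $$V(K)\le V(D).$$ Moreover, $g_K(x)\le g_D(x)$ for every $x\in\mathbb R^2$ that is a point of $S$ or lies in at most one closed triangle of $K$ (that is, for every $x$ outside the relative interiors of the edges shared by two triangles of $K$). -/

import Mathlib

open MeasureTheory

noncomputable section

namespace VoronoiFunctional

/-- The Euclidean plane. -/
abbrev Plane : Type := EuclideanSpace ℝ (Fin 2)

/-! Triangles are represented by the finite sets of their three vertices; the closed triangle is the
convex hull of that set. -/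

/-- All interior angles of the triangle with vertex set `Δ` are smaller than `π / 2`. -/
def IsAcute (Δ : Finset Plane) : Prop :=
  ∀ p ∈ Δ, ∀ q ∈ Δ, ∀ r ∈ Δ, p ≠ q → q ≠ r → p ≠ r → EuclideanGeometry.angle p q r < Real.pi / 2

/-- The area of the triangle with vertex set `Δ`. -/
def area (Δ : Finset Plane) : ℝ := volume.real (convexHull ℝ (Δ : Set Plane))

/-- The sum of the squared edge lengths (each edge appears twice in the double sum). -/
def sumSqEdges (Δ : Finset Plane) : ℝ := (∑ p ∈ Δ, ∑ q ∈ Δ, dist p q ^ 2) / 2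

/-- The circumradius: the radius of the smallest circle that passes through all the vertices. -/
def circumradius (Δ : Finset Plane) : ℝ :=
  sInf {r : ℝ | ∃ c : Plane, ∀ v ∈ Δ, dist v c = r}

open Classical in
/-- The Voronoi functional of a triangle. For an acute triangle it is the integral, over the
triangle, of the squared distance to the nearest vertex; for a non-acute triangle it is
`area / 12 * (a ^ 2 + b ^ 2 + c ^ 2 - 4 * R ^ 2)`. -/
def triangleVoronoi (Δ : Finset Plane) : ℝ :=
  if IsAcute Δ then
    ∫ x in convexHull ℝ (Δ : Set Plane), Metric.infDist x (Δ : Set Plane) ^ 2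
  else
    area Δ / 12 * (sumSqEdges Δ - 4 * circumradius Δ ^ 2)

/-- The Voronoi functional of a finite family of triangles. -/
def voronoi (T : Finset (Finset Plane)) : ℝ := ∑ Δ ∈ T, triangleVoronoi Δ

/-- The vertices of `Δ` visible from `x`: the segment from `x` to the vertex meets the closed
triangle only in this vertex. -/
def visibleVertices (Δ : Finset Plane) (x : Plane) : Set Plane :=
  {v | v ∈ Δ ∧ segment ℝ x v ∩ convexHull ℝ (Δ : Set Plane) = {v}}

/-- The local Voronoi functional of a triangle: the squared distance from `x` to the nearest vertex
minus the squared distance from `x` to the nearest visible vertex. If no vertex is visible, the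
second term is `0`, which is the value of `Metric.infDist x ∅`. -/
def localTriangle (Δ : Finset Plane) (x : Plane) : ℝ :=
  Metric.infDist x (Δ : Set Plane) ^ 2 - Metric.infDist x (visibleVertices Δ x) ^ 2

/-- The local Voronoi functional of a finite family of triangles. -/
def localVoronoi (T : Finset (Finset Plane)) (x : Plane) : ℝ := ∑ Δ ∈ T, localTriangle Δ x

/-- General position: no four points of `S` lie on a common circle. -/
def GeneralPosition (S : Finset Plane) : Prop :=
  ∀ Q ⊆ S, Q.card = 4 → ¬ EuclideanGeometry.Cospherical (Q : Set Plane)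

/-- No point of `S` is enclosed by the circle through the vertices of `Δ`. -/
def EmptyCircumcircle (S Δ : Finset Plane) : Prop :=
  ∃ (c : Plane) (r : ℝ), (∀ v ∈ Δ, dist v c = r) ∧ ∀ p ∈ S, r ≤ dist p c

open Classical in
/-- The Delaunay triangulation, as the family of its triangles: all (non-degenerate) triangles
spanned by three points of `S` whose circumcircle encloses no point of `S`. -/
def delaunay (S : Finset Plane) : Finset (Finset Plane) :=
  {Δ ∈ S.powersetCard 3 |
    AffineIndependent ℝ ((↑) : Δ → Plane) ∧ EmptyCircumcircle S Δ}

/-- `K` is a geometric triangulation of `S`: a simplicial complex in the plane with vertex set `S`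
whose underlying space is the convex hull of `S`. -/
structure IsGeometricTriangulation (S : Finset Plane) (K : Geometry.SimplicialComplex ℝ Plane) :
    Prop where
  vertices_eq : K.vertices = (S : Set Plane)
  space_eq : K.space = convexHull ℝ (S : Set Plane)

open Classical in
/-- The triangles of a simplicial complex `K` with vertex set `S`. -/
def triangles (S : Finset Plane) (K : Geometry.SimplicialComplex ℝ Plane) :
    Finset (Finset Plane) :=
  {Δ ∈ S.powersetCard 3 | Δ ∈ K.faces}

end VoronoiFunctional

end

/-!
Fix `x` and order everything by the squared radius `t = ρ ^ 2`. If `x` lies outside a triangle `Δ`,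
then `- localTriangle Δ x` is the length of the interval of those `t` for which the closed disk of
radius `ρ` about `x` contains a vertex of `Δ` that is hidden behind the opposite edge while the ends
of that edge lie outside the disk. If `x` lies in `Δ`, then `localTriangle Δ x` is the squared
distance to the nearest vertex.

The intervals of the Delaunay triangles are disjoint. If `t` lay in those of `T` and `T'`, then for
one of the two hiding edges the difference of the powers with respect to the two circumcircles would
be an affine function that is nonpositive at the ends of the edge and nonnegative at points of the
disk on both sides of it. Such a function vanishes, so the circumcircles would coincide. In the same
way, for `x ∈ conv S` all these intervals end before the squared distance from `x` to the vertices
of a Delaunay triangle containing `x`, so the Delaunay sum is at least the squared distance from `x`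
to `S`. For an arbitrary triangulation, follow a segment from `x` to a point of `S` in the disk:
where it last leaves the triangles without vertices in the disk, it enters a triangle through an
edge that hides a vertex in the disk. Hence the intervals cover the range between the squared
distances to `S` and to the vertices of the triangle containing `x`, and the sum is at most the
squared distance to `S`. For `x ∉ conv S`, the same walk starts at the point of `conv S` nearest to
`x` and shows that every interval of a Delaunay triangle is covered by those of `K`.

The inequality of the Voronoi functionals follows by integration, since the Voronoi functional of a
triangle is the integral of its local functional. If the triangle is not acute, then almost
everywhere the local functional is a signed sum of the functions `min (dist x p ^ 2) (dist x q ^ 2)`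
on the three isosceles triangles spanned by an edge `pq` and the circumcenter.
-/

noncomputable section

namespace VoronoiFunctional

/-! ### Barycentric coordinates -/

section AffineBasis

variable {ι E : Type*} [AddCommGroup E] [Module ℝ E]

theorem exists_lineMap_eq_zero {f : E →ᵃ[ℝ] ℝ} {x y : E} (hx : f x ≤ 0) (hy : 0 < f y) :
    ∃ t ∈ Set.Ico (0 : ℝ) 1, f (AffineMap.lineMap x y t) = 0 := by
  have hpos : 0 < f y - f x := by linarith
  refine ⟨-f x / (f y - f x), ⟨div_nonneg (neg_nonneg.2 hx) hpos.le, ?_⟩, ?_⟩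
  · rw [div_lt_one hpos]
    linarith
  · rw [AffineMap.apply_lineMap, AffineMap.lineMap_apply_ring']
    field_simp
    ring

theorem affineMap_apply_eq_sum_coord_smul [Fintype ι] {V : Type*} [AddCommGroup V] [Module ℝ V]
    (B : AffineBasis ι ℝ E) (f : E →ᵃ[ℝ] V) (x : E) : f x = ∑ i, B.coord i x • f (B i) := by
  have h := congrArg f (B.affineCombination_coord_eq_self x)
  rw [Finset.map_affineCombination _ _ _ (B.sum_coord_apply_eq_one x),
    Finset.affineCombination_eq_linear_combination _ _ _ (B.sum_coord_apply_eq_one x)] at h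
  simpa using h.symm

theorem affineMap_apply_eq_sum_coord [Fintype ι] (B : AffineBasis ι ℝ E) (f : E →ᵃ[ℝ] ℝ) (x : E) :
    f x = ∑ i, B.coord i x * f (B i) :=
  affineMap_apply_eq_sum_coord_smul B f x

theorem mem_convexHull_range_iff (B : AffineBasis ι ℝ E) {x : E} :
    x ∈ convexHull ℝ (Set.range B) ↔ ∀ i, 0 ≤ B.coord i x := by
  rw [B.convexHull_eq_nonneg_coord, Set.mem_ofPred_eq]

end AffineBasis

section Triangle

/-- `Δ` is the vertex set of a nondegenerate triangle. -/
def IsTriangle (Δ : Finset Plane) : Prop :=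
  Δ.card = 3 ∧ AffineIndependent ℝ ((↑) : Δ → Plane)

variable {Δ : Finset Plane} {B : AffineBasis (Fin 3) ℝ Plane} {x : Plane}

theorem IsTriangle.nonempty (hT : IsTriangle Δ) : Δ.Nonempty :=
  Finset.card_pos.1 (by rw [hT.1]; norm_num)

theorem IsTriangle.exists_basis (hT : IsTriangle Δ) {r : Plane} (hr : r ∈ Δ) :
    ∃ B : AffineBasis (Fin 3) ℝ Plane, (Δ : Set Plane) = Set.range B ∧ B 2 = r := by
  have htop : affineSpan ℝ (Set.range ((↑) : Δ → Plane)) = ⊤ := by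
    rw [hT.2.affineSpan_eq_top_iff_card_eq_finrank_add_one, Fintype.card_coe, hT.1,
      finrank_euclideanSpace_fin]
  let b : AffineBasis Δ ℝ Plane := ⟨(↑), hT.2, htop⟩
  let e : Δ ≃ Fin 3 := Δ.equivFinOfCardEq hT.1
  refine ⟨b.reindex (e.trans (Equiv.swap (e ⟨r, hr⟩) 2)), ?_, ?_⟩
  · rw [AffineBasis.coe_reindex, EquivLike.range_comp]
    exact Subtype.range_coe.symm
  · rw [AffineBasis.reindex_apply, Equiv.symm_trans_apply, Equiv.symm_swap, Equiv.swap_apply_right,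
      Equiv.symm_apply_apply]
    rfl

theorem mem_iff_exists_eq (hΔ : (Δ : Set Plane) = Set.range B) : x ∈ Δ ↔ ∃ i, B i = x := by
  rw [← Finset.mem_coe, hΔ, Set.mem_range]

theorem basis_mem (hΔ : (Δ : Set Plane) = Set.range B) (i : Fin 3) : B i ∈ Δ :=
  (mem_iff_exists_eq hΔ).2 ⟨i, rfl⟩

theorem mem_hull_iff (hΔ : (Δ : Set Plane) = Set.range B) :
    x ∈ convexHull ℝ (Δ : Set Plane) ↔ ∀ i, 0 ≤ B.coord i x := by
  rw [hΔ, mem_convexHull_range_iff]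

theorem mem_visibleVertices_iff_lineMap {v : Plane} (hv : v ∈ Δ) :
    v ∈ visibleVertices Δ x ↔ ∀ t ∈ Set.Icc (0 : ℝ) 1,
      AffineMap.lineMap v x t ∈ convexHull ℝ (Δ : Set Plane) → AffineMap.lineMap v x t = v := by
  rw [visibleVertices, Set.mem_ofPred_eq, and_iff_right hv, segment_symm,
    segment_eq_image_lineMap, Set.Subset.antisymm_iff, and_iff_left, Set.inter_subset,
    Set.image_subset_iff]
  · exact forall₂_congr fun t _ => by
      rw [Set.mem_preimage, Set.mem_union, Set.mem_compl_iff, Set.mem_singleton_iff, imp_iff_not_or]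
  · exact Set.singleton_subset_iff.2
      ⟨⟨0, by simp, AffineMap.lineMap_apply_zero v x⟩, subset_convexHull ℝ _ hv⟩

theorem mem_visibleVertices_iff (hΔ : (Δ : Set Plane) = Set.range B) {i : Fin 3} :
    B i ∈ visibleVertices Δ x ↔ x = B i ∨ ∃ j ≠ i, B.coord j x < 0 := by
  have hcoord (j : Fin 3) (t : ℝ) : B.coord j (AffineMap.lineMap (B i) x t) =
      (1 - t) * B.coord j (B i) + t * B.coord j x := by
    rw [AffineMap.apply_lineMap, AffineMap.lineMap_apply_ring]
  simp only [mem_visibleVertices_iff_lineMap (basis_mem hΔ i), mem_hull_iff hΔ, hcoord]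
  constructor
  · intro h
    by_contra! hx
    set t : ℝ := (1 + |B.coord i x|)⁻¹
    have ht : 0 < t := by positivity
    have ht1 : t ≤ 1 := inv_le_one_of_one_le₀ (by linarith [abs_nonneg (B.coord i x)])
    have hti : t * (1 + |B.coord i x|) = 1 := inv_mul_cancel₀ (by positivity)
    have hnonneg (j : Fin 3) : 0 ≤ (1 - t) * B.coord j (B i) + t * B.coord j x := by
      rcases eq_or_ne j i with rfl | hj
      · rw [B.coord_apply_eq]
        have := mul_le_mul_of_nonneg_left (neg_abs_le (B.coord j x)) ht.le
        linarith
      · rw [B.coord_apply_ne hj, mul_zero, zero_add]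
        exact mul_nonneg ht.le (hx.2 j hj)
    exact hx.1 (((AffineMap.lineMap_eq_left_iff).1 (h t ⟨ht.le, ht1⟩ hnonneg)).resolve_right
      ht.ne').symm
  · rintro (rfl | ⟨j, hji, hj⟩) t ht hnonneg
    · exact AffineMap.lineMap_same_apply _ _
    · have := hnonneg j
      rw [B.coord_apply_ne hji, mul_zero, zero_add] at this
      have ht0 : t = 0 := by nlinarith [ht.1]
      rw [ht0, AffineMap.lineMap_apply_zero]

end Triangle

section InfDist

variable {α : Type*} [PseudoMetricSpace α] {s : Set α} {x : α} {ρ : ℝ}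

theorem infDist_le_iff_of_finite (hs : s.Finite) (hne : s.Nonempty) :
    Metric.infDist x s ≤ ρ ↔ ∃ v ∈ s, dist v x ≤ ρ := by
  constructor
  · intro h
    obtain ⟨v, hv, hdist⟩ := hs.isCompact.exists_infDist_eq_dist hne x
    exact ⟨v, hv, by rwa [dist_comm, ← hdist]⟩
  · rintro ⟨v, hv, h⟩
    exact (Metric.infDist_le_dist_of_mem hv).trans (by rwa [dist_comm])

theorem lt_infDist_iff_of_finite (hs : s.Finite) (hne : s.Nonempty) :
    ρ < Metric.infDist x s ↔ ∀ v ∈ s, ρ < dist v x := by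
  rw [← not_le, infDist_le_iff_of_finite hs hne]
  push Not
  rfl

end InfDist

section BasisPoint

variable {ι E : Type*} [AddCommGroup E] [Module ℝ E] [Finite ι]

theorem eq_basis_of_forall_coord_eq_zero (B : AffineBasis ι ℝ E) {i : ι} {x : E}
    (h : ∀ j ≠ i, B.coord j x = 0) : x = B i := by
  have := Fintype.ofFinite ι
  classical
  refine B.ext_elem fun j => ?_
  rcases eq_or_ne j i with rfl | hj
  · rw [B.coord_apply_eq, ← B.sum_coord_apply_eq_one x, Finset.sum_eq_single j
      (fun k _ hk => h k hk) (fun hj => (hj (Finset.mem_univ j)).elim)]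
  · rw [h j hj, B.coord_apply_ne hj]

end BasisPoint

section Power

theorem power_eq_zero_of_mem {P : Type*} [MetricSpace P] {s : EuclideanGeometry.Sphere P} {p : P}
    (hp : p ∈ s) : s.power p = 0 := by
  rw [EuclideanGeometry.Sphere.power, EuclideanGeometry.mem_sphere.1 hp, sub_self]

variable {V : Type*} [NormedAddCommGroup V] [InnerProductSpace ℝ V]
  (s₁ s₂ : EuclideanGeometry.Sphere V)

/-- The difference of the powers of a point with respect to two spheres, an affine function: it
vanishes on the radical axis. -/
def powerDiff : V →ᵃ[ℝ] ℝ :=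
  ((2 : ℝ) • innerₗ V (s₂.center - s₁.center)).toAffineMap +
    AffineMap.const ℝ V (‖s₁.center‖ ^ 2 - s₁.radius ^ 2 - (‖s₂.center‖ ^ 2 - s₂.radius ^ 2))

theorem powerDiff_apply (x : V) : powerDiff s₁ s₂ x = s₁.power x - s₂.power x := by
  simp only [powerDiff, EuclideanGeometry.Sphere.power, dist_eq_norm, norm_sub_sq_real,
    AffineMap.coe_add, Pi.add_apply, LinearMap.coe_toAffineMap, LinearMap.smul_apply,
    innerₗ_apply_apply, AffineMap.const_apply, inner_sub_left, smul_eq_mul]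
  rw [real_inner_comm x, real_inner_comm x]
  ring

end Power

/-! ### Visible and hidden vertices -/

section Visibility

variable {Δ : Finset Plane} {B : AffineBasis (Fin 3) ℝ Plane} {x y z : Plane} {ρ : ℝ}

theorem IsTriangle.visibleVertices_nonempty (hT : IsTriangle Δ)
    (hx : x ∉ convexHull ℝ (Δ : Set Plane)) : (visibleVertices Δ x).Nonempty := by
  obtain ⟨B, hΔ, -⟩ := hT.exists_basis hT.nonempty.choose_spec
  obtain ⟨j, hj⟩ : ∃ j, B.coord j x < 0 := by simpa [mem_hull_iff hΔ] using hx
  obtain ⟨i, hij⟩ := exists_ne j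
  exact ⟨B i, (mem_visibleVertices_iff hΔ).2 (.inr ⟨j, hij.symm, hj⟩)⟩

theorem finite_visibleVertices (Δ : Finset Plane) (x : Plane) : (visibleVertices Δ x).Finite :=
  Δ.finite_toSet.subset fun _ hv => hv.1

/-- The edge `B 0 B 1` hides the vertex `B 2` of a triangle from `x`, and `B 2` is the only vertex
at distance at most `ρ` from `x`. The squares of these radii `ρ` fill an interval of length
`-localTriangle`, see `hidesVertex_iff`. -/
structure Hides (B : AffineBasis (Fin 3) ℝ Plane) (x : Plane) (ρ : ℝ) : Prop where
  coord_nonneg : ∀ i ≠ 2, 0 ≤ B.coord i x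
  coord_neg : B.coord 2 x < 0
  dist_le : dist (B 2) x ≤ ρ
  lt_dist : ∀ i ≠ 2, ρ < dist (B i) x

/-- Some edge of the triangle `Δ` hides the opposite vertex from `x`, and this is the only vertex of
`Δ` at distance at most `ρ` from `x`. -/
def HidesVertex (Δ : Finset Plane) (x : Plane) (ρ : ℝ) : Prop :=
  ∃ B : AffineBasis (Fin 3) ℝ Plane, (Δ : Set Plane) = Set.range B ∧ Hides B x ρ

theorem Hides.notMem_hull (h : Hides B x ρ) (hΔ : (Δ : Set Plane) = Set.range B) :
    x ∉ convexHull ℝ (Δ : Set Plane) := fun hx =>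
  h.coord_neg.not_ge ((mem_hull_iff hΔ).1 hx 2)

theorem Hides.nonneg (h : Hides B x ρ) : 0 ≤ ρ :=
  dist_nonneg.trans h.dist_le

theorem Hides.mem_closedBall (h : Hides B x ρ) : x ∈ Metric.closedBall x ρ :=
  Metric.mem_closedBall_self h.nonneg

theorem hides_of_dist_le (hΔ : (Δ : Set Plane) = Set.range B)
    (hx : x ∉ convexHull ℝ (Δ : Set Plane)) (h2 : dist (B 2) x ≤ ρ)
    (hvis : ∀ v ∈ visibleVertices Δ x, ρ < dist v x) : Hides B x ρ := by
  have hhidden : B 2 ∉ visibleVertices Δ x := fun hv => (hvis _ hv).not_ge h2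
  rw [mem_visibleVertices_iff hΔ] at hhidden
  push Not at hhidden
  have hneg : B.coord 2 x < 0 := by
    by_contra! hpos
    refine hx ((mem_hull_iff hΔ).2 fun i => ?_)
    rcases eq_or_ne i 2 with rfl | hi
    exacts [hpos, hhidden.2 i hi]
  exact ⟨hhidden.2, hneg, h2, fun i hi =>
    hvis _ ((mem_visibleVertices_iff hΔ).2 (.inr ⟨2, hi.symm, hneg⟩))⟩

theorem hidesVertex_iff (hT : IsTriangle Δ) (hx : x ∉ convexHull ℝ (Δ : Set Plane)) :
    HidesVertex Δ x ρ ↔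
      Metric.infDist x Δ ≤ ρ ∧ ρ < Metric.infDist x (visibleVertices Δ x) := by
  rw [infDist_le_iff_of_finite Δ.finite_toSet hT.nonempty, lt_infDist_iff_of_finite
    (finite_visibleVertices Δ x) (hT.visibleVertices_nonempty hx)]
  constructor
  · rintro ⟨B, hΔ, h⟩
    refine ⟨⟨B 2, basis_mem hΔ 2, h.dist_le⟩, fun v hv => ?_⟩
    obtain ⟨i, rfl⟩ := (mem_iff_exists_eq hΔ).1 hv.1
    refine h.lt_dist i ?_
    rintro rfl
    rcases (mem_visibleVertices_iff hΔ).1 hv with rfl | ⟨j, hj, hneg⟩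
    · exact h.notMem_hull hΔ (subset_convexHull ℝ _ (basis_mem hΔ 2))
    · exact hneg.not_ge (h.coord_nonneg j hj)
  · rintro ⟨⟨r, hr, hrx⟩, hvis⟩
    obtain ⟨B, hΔ, rfl⟩ := hT.exists_basis hr
    exact ⟨B, hΔ, hides_of_dist_le hΔ hx hrx hvis⟩

theorem coord_pos_of_mem_closedBall (hfar : ∀ i ≠ 2, ρ < dist (B i) x)
    (hy : y ∈ Metric.closedBall x ρ) (hz : z ∈ Metric.closedBall x ρ)
    (hy2 : B.coord 2 y = 0) (hz2 : B.coord 2 z = 0) {i : Fin 3} (hyi : 0 ≤ B.coord i y)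
    (hi : i ≠ 2) : 0 < B.coord i z := by
  obtain ⟨j, hj2, hj⟩ : ∃ j, j ≠ 2 ∧ ∀ k, k ≠ j → k = i ∨ k = 2 := by
    clear hyi
    revert i
    decide
  have hne {w : Plane} (hw : w ∈ Metric.closedBall x ρ) (hw2 : B.coord 2 w = 0) :
      B.coord i w ≠ 0 := by
    intro hwi
    have hwj : w = B j := eq_basis_of_forall_coord_eq_zero B fun k hk => by
      rcases hj k hk with rfl | rfl
      exacts [hwi, hw2]
    exact (hfar j hj2).not_ge (hwj ▸ hw)
  by_contra! hzi
  obtain ⟨t, ht, hti⟩ := exists_lineMap_eq_zero hzi (hyi.lt_of_ne' (hne hy hy2))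
  refine hne ((convex_closedBall x ρ).lineMap_mem hz hy ⟨ht.1, ht.2.le⟩) ?_ hti
  rw [AffineMap.apply_lineMap, hy2, hz2, AffineMap.lineMap_same_apply]

/-- The disk of radius `ρ` about `x` contains the vertex `B 2` of a triangle and the point `y` of
the opposite edge, but neither endpoint of that edge. -/
structure CutsEdge (B : AffineBasis (Fin 3) ℝ Plane) (x : Plane) (ρ : ℝ) (y : Plane) : Prop where
  dist_le : dist (B 2) x ≤ ρ
  lt_dist : ∀ i ≠ 2, ρ < dist (B i) x
  mem_closedBall : y ∈ Metric.closedBall x ρ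
  coord_eq_zero : B.coord 2 y = 0
  coord_nonneg : ∀ i, 0 ≤ B.coord i y

theorem CutsEdge.hides (h : CutsEdge B x ρ y) (hx : B.coord 2 x < 0) : Hides B x ρ := by
  refine ⟨fun i hi => ?_, hx, h.dist_le, h.lt_dist⟩
  obtain ⟨t, ht, ht2⟩ := exists_lineMap_eq_zero hx.le
    (show 0 < B.coord 2 (B 2) by rw [B.coord_apply_eq]; exact one_pos)
  have hz := (convex_closedBall x ρ).lineMap_mem
    (Metric.mem_closedBall_self (dist_nonneg.trans h.dist_le)) h.dist_le ⟨ht.1, ht.2.le⟩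
  have hpos := coord_pos_of_mem_closedBall h.lt_dist h.mem_closedBall hz h.coord_eq_zero ht2
    (h.coord_nonneg i) hi
  rw [AffineMap.apply_lineMap, AffineMap.lineMap_apply_ring, B.coord_apply_ne hi, mul_zero,
    add_zero] at hpos
  exact (pos_of_mul_pos_right hpos (by linarith [ht.2])).le

theorem Hides.coord_pos_of_mem_closedBall (h : Hides B x ρ) (hz : z ∈ Metric.closedBall x ρ)
    (hz2 : B.coord 2 z = 0) {i : Fin 3} (hi : i ≠ 2) : 0 < B.coord i z := by
  obtain ⟨t, ht, ht2⟩ := exists_lineMap_eq_zero h.coord_neg.le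
    (show 0 < B.coord 2 (B 2) by rw [B.coord_apply_eq]; exact one_pos)
  refine VoronoiFunctional.coord_pos_of_mem_closedBall h.lt_dist
    ((convex_closedBall x ρ).lineMap_mem h.mem_closedBall h.dist_le ⟨ht.1, ht.2.le⟩) hz ht2 hz2
    ?_ hi
  rw [AffineMap.apply_lineMap, AffineMap.lineMap_apply_ring, B.coord_apply_ne hi, mul_zero,
    add_zero]
  exact mul_nonneg (by linarith [ht.2]) (h.coord_nonneg i hi)

end Visibility

section EmptyCircle

variable {B : AffineBasis (Fin 3) ℝ Plane} {x z : Plane} {ρ : ℝ}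

-- Otherwise the segment from `z` to `B 2` crosses the edge line at a point `y` of the disk
-- between `B 0` and `B 1`. Interpolating from `z` and `B 2`, the power of `y` with respect to `s`
-- is at least the one with respect to the disk; interpolating from `B 0` and `B 1`, it is smaller.
theorem Hides.coord_pos_of_power_nonneg (h : Hides B x ρ) {s : EuclideanGeometry.Sphere Plane}
    (hB : ∀ i, B i ∈ s) (hz : z ∈ Metric.closedBall x ρ) (hzs : 0 ≤ s.power z) :
    0 < B.coord 2 z := by
  by_contra! hz2
  let ball : EuclideanGeometry.Sphere Plane := ⟨x, ρ⟩
  have hball {w : Plane} : ball.power w ≤ 0 ↔ w ∈ Metric.closedBall x ρ :=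
    EuclideanGeometry.Sphere.power_nonpos_iff_dist_center_le_radius h.nonneg
  obtain ⟨t, ht, ht2⟩ := exists_lineMap_eq_zero hz2
    (show 0 < B.coord 2 (B 2) by rw [B.coord_apply_eq]; exact one_pos)
  set y : Plane := AffineMap.lineMap z (B 2) t
  have hy : y ∈ Metric.closedBall x ρ :=
    (convex_closedBall x ρ).lineMap_mem hz h.dist_le ⟨ht.1, ht.2.le⟩
  have hnonneg : 0 ≤ powerDiff s ball y := by
    rw [AffineMap.apply_lineMap, AffineMap.lineMap_apply_ring, powerDiff_apply, powerDiff_apply,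
      power_eq_zero_of_mem (hB 2)]
    exact add_nonneg (mul_nonneg (by linarith [ht.2]) (by linarith [hball.2 hz]))
      (mul_nonneg ht.1 (by linarith [hball.2 (show B 2 ∈ _ from h.dist_le)]))
  have hneg {i : Fin 3} (hi : i ≠ 2) : B.coord i y * powerDiff s ball (B i) < 0 := by
    refine mul_neg_of_pos_of_neg (h.coord_pos_of_mem_closedBall hy ht2 hi) ?_
    have : ¬ ball.power (B i) ≤ 0 := fun hi' => (h.lt_dist i hi).not_ge (hball.1 hi')
    rw [powerDiff_apply, power_eq_zero_of_mem (hB i)]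
    linarith
  rw [affineMap_apply_eq_sum_coord B, Fin.sum_univ_three, ht2] at hnonneg
  linarith [hneg (i := 0) (by decide), hneg (i := 1) (by decide)]

theorem Hides.affineMap_eq_zero (h : Hides B x ρ) (hz : z ∈ Metric.closedBall x ρ)
    (hz2 : 0 < B.coord 2 z) {f : Plane →ᵃ[ℝ] ℝ} (hfB : ∀ i ≠ 2, f (B i) ≤ 0) (hfx : 0 ≤ f x)
    (hfz : 0 ≤ f z) (i : Fin 3) : f (B i) = 0 := by
  obtain ⟨t, ht, ht2⟩ := exists_lineMap_eq_zero h.coord_neg.le hz2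
  set y : Plane := AffineMap.lineMap x z t
  have hy : y ∈ Metric.closedBall x ρ :=
    (convex_closedBall x ρ).lineMap_mem h.mem_closedBall hz ⟨ht.1, ht.2.le⟩
  have hpos {i : Fin 3} (hi : i ≠ 2) : 0 < B.coord i y :=
    h.coord_pos_of_mem_closedBall hy ht2 hi
  have hle {i : Fin 3} (hi : i ≠ 2) : B.coord i y * f (B i) ≤ 0 :=
    mul_nonpos_of_nonneg_of_nonpos (hpos hi).le (hfB i hi)
  have hfy : f y = (1 - t) * f x + t * f z := by
    rw [AffineMap.apply_lineMap, AffineMap.lineMap_apply_ring]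
  have hfy' : f y = B.coord 0 y * f (B 0) + B.coord 1 y * f (B 1) := by
    rw [affineMap_apply_eq_sum_coord B, Fin.sum_univ_three, ht2, zero_mul, add_zero]
  have hx1 : 0 ≤ (1 - t) * f x := mul_nonneg (by linarith [ht.2]) hfx
  have hz1 : 0 ≤ t * f z := mul_nonneg ht.1 hfz
  have h0 := hle (i := 0) (by decide)
  have h1 := hle (i := 1) (by decide)
  have hf0 : f (B 0) = 0 :=
    (mul_eq_zero.1 (by linarith : B.coord 0 y * f (B 0) = 0)).resolve_left (hpos (by decide)).ne'
  have hf1 : f (B 1) = 0 :=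
    (mul_eq_zero.1 (by linarith : B.coord 1 y * f (B 1) = 0)).resolve_left (hpos (by decide)).ne'
  have hfx0 : f x = 0 :=
    (mul_eq_zero.1 (by linarith : (1 - t) * f x = 0)).resolve_left (by linarith [ht.2])
  rw [affineMap_apply_eq_sum_coord B, Fin.sum_univ_three, hf0, hf1, mul_zero, mul_zero, zero_add,
    zero_add] at hfx0
  have hf2 : f (B 2) = 0 := (mul_eq_zero.1 hfx0).resolve_left h.coord_neg.ne
  fin_cases i
  exacts [hf0, hf1, hf2]

end EmptyCircle

section Delaunay

variable {S T T' : Finset Plane} {B : AffineBasis (Fin 3) ℝ Plane} {w x : Plane} {ρ : ℝ}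
  {s s' : EuclideanGeometry.Sphere Plane}

theorem GeneralPosition.mem_of_mem_sphere (hS : GeneralPosition S) (hT : T ⊆ S)
    (hcard : T.card = 3) (hTs : ∀ v ∈ T, v ∈ s) (hw : w ∈ S) (hws : w ∈ s) : w ∈ T := by
  by_contra hwT
  refine hS (Finset.cons w T hwT) (Finset.cons_subset.2 ⟨hw, hT⟩)
    (by rw [Finset.card_cons, hcard]) ⟨s.center, s.radius, fun v hv => ?_⟩
  rcases Finset.mem_cons.1 hv with rfl | hv
  exacts [hws, hTs v hv]

open Classical in
theorem mem_delaunay_iff : T ∈ delaunay S ↔ T ⊆ S ∧ IsTriangle T ∧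
    ∃ s : EuclideanGeometry.Sphere Plane, (∀ v ∈ T, v ∈ s) ∧ ∀ p ∈ S, 0 ≤ s.power p := by
  rw [delaunay, Finset.mem_filter, Finset.mem_powersetCard, IsTriangle, and_assoc, and_assoc]
  refine and_congr_right fun _ => and_congr_right fun hcard => and_congr_right fun _ => ?_
  obtain ⟨v₀, hv₀⟩ : T.Nonempty := Finset.card_pos.1 (by rw [hcard]; norm_num)
  constructor
  · rintro ⟨c, r, hT, hS⟩
    have hr : 0 ≤ r := hT v₀ hv₀ ▸ dist_nonneg
    exact ⟨⟨c, r⟩, hT, fun p hp =>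
      (EuclideanGeometry.Sphere.power_nonneg_iff_radius_le_dist_center hr).2 (hS p hp)⟩
  · rintro ⟨s, hT, hS⟩
    have hr : 0 ≤ s.radius := (show dist v₀ s.center = s.radius from hT v₀ hv₀) ▸ dist_nonneg
    exact ⟨s.center, s.radius, hT, fun p hp =>
      (EuclideanGeometry.Sphere.power_nonneg_iff_radius_le_dist_center hr).1 (hS p hp)⟩

theorem Hides.eq_of_power_le (h : Hides B x ρ) (hB : (T : Set Plane) = Set.range B)
    (hS : GeneralPosition S) (hT : T ∈ delaunay S) (hT' : T' ∈ delaunay S)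
    (hs : ∀ v ∈ T, v ∈ s) (hsS : ∀ p ∈ S, 0 ≤ s.power p)
    (hs' : ∀ v ∈ T', v ∈ s') (hs'S : ∀ p ∈ S, 0 ≤ s'.power p)
    (hw : w ∈ T') (hwx : dist w x ≤ ρ) (hle : s'.power x ≤ s.power x) : T = T' := by
  rw [mem_delaunay_iff] at hT hT'
  have hwS : w ∈ S := hT'.1 hw
  have hBs (i : Fin 3) : B i ∈ s := hs _ (basis_mem hB i)
  have hBS (i : Fin 3) : B i ∈ S := hT.1 (basis_mem hB i)
  have hdiff : ∀ i, powerDiff s s' (B i) = 0 := by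
    refine h.affineMap_eq_zero hwx (h.coord_pos_of_power_nonneg hBs hwx (hsS w hwS)) (fun i _ => ?_)
      ?_ ?_ <;> rw [powerDiff_apply]
    · rw [power_eq_zero_of_mem (hBs i), zero_sub, neg_nonpos]
      exact hs'S _ (hBS i)
    · exact sub_nonneg.2 hle
    · rw [power_eq_zero_of_mem (hs' w hw), sub_zero]
      exact hsS w hwS
  have hr' : 0 ≤ s'.radius := (hs' w hw : dist w s'.center = s'.radius) ▸ dist_nonneg
  refine Finset.eq_of_subset_of_card_le (fun v hv => ?_) (by rw [hT.2.1.1, hT'.2.1.1])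
  obtain ⟨i, rfl⟩ := (mem_iff_exists_eq hB).1 hv
  refine hS.mem_of_mem_sphere hT'.1 hT'.2.1.1 hs' (hBS i) ?_
  rw [← EuclideanGeometry.Sphere.power_eq_zero_iff_mem_sphere hr']
  have := hdiff i
  rwa [powerDiff_apply, power_eq_zero_of_mem (hBs i), zero_sub, neg_eq_zero] at this

theorem HidesVertex.eq_of_mem_delaunay (h : HidesVertex T x ρ) (h' : HidesVertex T' x ρ)
    (hS : GeneralPosition S) (hT : T ∈ delaunay S) (hT' : T' ∈ delaunay S) : T = T' := by
  obtain ⟨B, hB, h⟩ := h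
  obtain ⟨B', hB', h'⟩ := h'
  obtain ⟨-, -, s, hs, hsS⟩ := mem_delaunay_iff.1 hT
  obtain ⟨-, -, s', hs', hs'S⟩ := mem_delaunay_iff.1 hT'
  rcases le_total (s'.power x) (s.power x) with hle | hle
  · exact h.eq_of_power_le hB hS hT hT' hs hsS hs' hs'S (basis_mem hB' 2) h'.dist_le hle
  · exact (h'.eq_of_power_le hB' hS hT' hT hs' hs'S hs hsS (basis_mem hB 2) h.dist_le hle).symm

theorem HidesVertex.lt_dist_of_mem_hull (h : HidesVertex T x ρ) (hS : GeneralPosition S)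
    (hT : T ∈ delaunay S) (hT' : T' ∈ delaunay S) (hx : x ∈ convexHull ℝ (T' : Set Plane))
    (hw : w ∈ T') : ρ < dist w x := by
  by_contra! hwx
  obtain ⟨B, hB, h⟩ := h
  obtain ⟨-, -, s, hs, hsS⟩ := mem_delaunay_iff.1 hT
  obtain ⟨hT'S, -, s', hs', hs'S⟩ := mem_delaunay_iff.1 hT'
  have hle : s'.power x ≤ s.power x := by
    have hsub : (T' : Set Plane) ⊆ powerDiff s s' ⁻¹' Set.Ici 0 := fun v hv => by
      rw [Set.mem_preimage, powerDiff_apply, power_eq_zero_of_mem (hs' v hv), sub_zero]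
      exact hsS v (hT'S hv)
    have := convexHull_min hsub ((convex_Ici 0).affine_preimage _) hx
    rwa [Set.mem_preimage, powerDiff_apply, Set.mem_Ici, sub_nonneg] at this
  obtain rfl := h.eq_of_power_le hB hS hT hT' hs hsS hs' hs'S hw hwx hle
  exact h.notMem_hull hB hx

end Delaunay

section MoveVertex

variable {ι E : Type*} [AddCommGroup E] [Module ℝ E] {B : AffineBasis ι ℝ E} {i : ι} {s x : E}

/-- The affine map that moves the basis point `B i` to `s` and fixes the other basis points. -/
def moveVertex (B : AffineBasis ι ℝ E) (i : ι) (s : E) : E →ᵃ[ℝ] E :=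
  AffineMap.id ℝ E + (LinearMap.toSpanSingleton ℝ E (s - B i)).toAffineMap.comp (B.coord i)

theorem moveVertex_apply : moveVertex B i s x = x + B.coord i x • (s - B i) := rfl

theorem det_linear_moveVertex [Module.Finite ℝ E] :
    LinearMap.det (moveVertex B i s).linear = B.coord i s := by
  have hlinear : (moveVertex B i s).linear =
      LinearMap.transvection (B.coord i).linear (s - B i) := by
    ext y
    simp [moveVertex, LinearMap.transvection.apply]
  rw [hlinear, LinearMap.transvection.det, ← vsub_eq_sub, AffineMap.linearMap_vsub,
    B.coord_apply_eq, vsub_eq_sub, add_sub_cancel]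

theorem range_update_eq [DecidableEq ι] :
    Set.range (Function.update B i s) = moveVertex B i s '' Set.range B := by
  rw [← Set.range_comp]
  congr 1
  ext j
  rcases eq_or_ne j i with rfl | hj
  · rw [Function.update_self, Function.comp_apply, moveVertex_apply, B.coord_apply_eq, one_smul,
      add_sub_cancel]
  · rw [Function.update_of_ne hj, Function.comp_apply, moveVertex_apply, B.coord_apply_ne hj.symm,
      zero_smul, add_zero]

theorem coord_add_smul_sub (j : ι) (t : ℝ) : B.coord j (x + t • (s - B i)) =
    B.coord j x + t * (B.coord j s - B.coord j (B i)) := by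
  rw [add_comm x, ← vadd_eq_add, AffineMap.map_vadd, map_smul, ← vsub_eq_sub,
    AffineMap.linearMap_vsub, vadd_eq_add, smul_eq_mul, vsub_eq_sub, add_comm]

variable [Finite ι]

theorem mem_convexHull_image_coord_pos (hx : ∀ i, 0 ≤ B.coord i x) :
    x ∈ convexHull ℝ (B '' {i | 0 < B.coord i x}) := by
  classical
  have := Fintype.ofFinite ι
  have hzero (i : ι) (_ : i ∈ Finset.univ) (hi : i ∉ Finset.univ.filter (0 < B.coord · x)) :
      B.coord i x = 0 := by
    rw [Finset.mem_filter_univ, not_lt] at hi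
    exact hi.antisymm (hx i)
  have hsum : ∑ i with 0 < B.coord i x, B.coord i x = 1 := by
    rw [Finset.sum_subset (Finset.filter_subset _ _) hzero, B.sum_coord_apply_eq_one]
  have hcomb : ∑ i with 0 < B.coord i x, B.coord i x • B i = x := by
    rw [Finset.sum_subset (Finset.filter_subset _ _)
      fun i hi hi' => by rw [hzero i hi hi', zero_smul], B.linear_combination_coord_eq_self]
  rw [← hcomb]
  exact (convex_convexHull ℝ _).sum_mem (fun i _ => hx i) hsum fun i hi =>
    subset_convexHull ℝ _ ⟨i, by simpa [hcomb] using hi, rfl⟩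

theorem mem_convexHull_range_update_iff [DecidableEq ι] (hs : B.coord i s ≠ 0) :
    x ∈ convexHull ℝ (Set.range (Function.update B i s)) ↔
      0 ≤ B.coord i x / B.coord i s ∧
        ∀ j ≠ i, B.coord i x / B.coord i s * B.coord j s ≤ B.coord j x := by
  have := Fintype.ofFinite ι
  rw [range_update_eq, ← AffineMap.image_convexHull]
  constructor
  · rintro ⟨y, hy, rfl⟩
    rw [mem_convexHull_range_iff] at hy
    have hi : B.coord i (moveVertex B i s y) / B.coord i s = B.coord i y := by
      rw [moveVertex_apply, coord_add_smul_sub, B.coord_apply_eq]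
      field_simp
      ring
    refine ⟨hi ▸ hy i, fun j hj => ?_⟩
    rw [hi, moveVertex_apply, coord_add_smul_sub, B.coord_apply_ne hj]
    linarith [hy j]
  · rintro ⟨hi, hj⟩
    set t : ℝ := B.coord i x / B.coord i s
    have ht : t * B.coord i s = B.coord i x := div_mul_cancel₀ _ hs
    refine ⟨x + -t • (s - B i), (mem_convexHull_range_iff B).2 fun j => ?_, ?_⟩
    · rw [coord_add_smul_sub]
      rcases eq_or_ne j i with rfl | hji
      · rw [B.coord_apply_eq]
        linarith
      · rw [B.coord_apply_ne hji]
        linarith [hj j hji]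
    · rw [moveVertex_apply, coord_add_smul_sub, B.coord_apply_eq,
        show B.coord i x + -t * (B.coord i s - 1) = t by rw [← ht]; ring, add_assoc, ← add_smul,
        neg_add_cancel, zero_smul, add_zero]

theorem exists_mem_convexHull_range_update [DecidableEq ι] (hx : ∀ i, 0 < B.coord i x)
    (s : E) : ∃ i, 0 < B.coord i s ∧ x ∈ convexHull ℝ (Set.range (Function.update B i s)) := by
  have := Fintype.ofFinite ι
  have := B.nonempty
  obtain ⟨i, hi⟩ := Finite.exists_max fun i => B.coord i s / B.coord i x
  have hs : 0 < B.coord i s := by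
    obtain ⟨j, -, hj⟩ : ∃ j ∈ Finset.univ, 0 < B.coord j s :=
      Finset.exists_lt_of_sum_lt (f := fun _ => (0 : ℝ)) (by simp [B.sum_coord_apply_eq_one])
    exact (div_pos_iff_of_pos_right (hx i)).1 ((div_pos hj (hx j)).trans_le (hi j))
  refine ⟨i, hs, (mem_convexHull_range_update_iff hs.ne').2
    ⟨(div_pos (hx i) hs).le, fun j _ => ?_⟩⟩
  rw [div_mul_eq_mul_div, div_le_iff₀ hs, mul_comm, mul_comm (B.coord j x)]
  exact (div_le_div_iff₀ (hx j) (hx i)).1 (by simpa only [mul_comm] using hi j)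

end MoveVertex

theorem subset_of_measure_sdiff_eq_zero {E : Type*} [NormedAddCommGroup E] [NormedSpace ℝ E]
    [MeasurableSpace E] {μ : Measure E} [μ.IsOpenPosMeasure] {C U : Set E} (hC : Convex ℝ C)
    (hi : (interior C).Nonempty) (hU : IsClosed U) (h : μ (C \ U) = 0) : C ⊆ U := by
  have h0 : μ (interior C \ U) = 0 :=
    measure_mono_null (Set.sdiff_subset_sdiff_left interior_subset) h
  rw [(isOpen_interior.sdiff hU).measure_eq_zero_iff μ, Set.sdiff_eq_empty] at h0
  calc C ⊆ closure C := subset_closure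
    _ = closure (interior C) := (hC.closure_interior_eq_closure_of_nonempty_interior hi).symm
    _ ⊆ U := closure_minimal h0 hU

/-! ### Triangles containing a generic point -/

section Generic

variable {S t T : Finset Plane} {x : Plane}

/-- The union of the lines through pairs of points of `S`, a null set. -/
def lineUnion (S : Finset Plane) : Set Plane :=
  ⋃ p ∈ S, ⋃ q ∈ S, (affineSpan ℝ ({p, q} : Set Plane) : Set Plane)

theorem volume_line (p q : Plane) :
    volume (affineSpan ℝ ({p, q} : Set Plane) : Set Plane) = 0 := by
  refine Measure.addHaar_affineSubspace _ _ fun h => ?_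
  have hrank := collinear_iff_finrank_le_one.1 (collinear_pair ℝ p q)
  rw [← direction_affineSpan, h, AffineSubspace.direction_top, finrank_top,
    finrank_euclideanSpace_fin] at hrank
  norm_num at hrank

theorem volume_lineUnion (S : Finset Plane) : volume (lineUnion S) = 0 :=
  (measure_biUnion_null_iff S.countable_toSet).2 fun p _ =>
    (measure_biUnion_null_iff S.countable_toSet).2 fun q _ => volume_line p q

theorem hull_subset_lineUnion (ht : t ⊆ S) (hcard : t.card ≤ 2) :
    convexHull ℝ (t : Set Plane) ⊆ lineUnion S := by
  intro x hx
  obtain ⟨p, hp⟩ : t.Nonempty := by simpa using convexHull_nonempty_iff.1 ⟨x, hx⟩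
  have hcard' : (t.erase p).card ≤ 1 := by
    rw [Finset.card_erase_of_mem hp]
    omega
  obtain ⟨q, hq, htpq⟩ : ∃ q ∈ S, (t : Set Plane) ⊆ {p, q} := by
    rcases (t.erase p).eq_empty_or_nonempty with he | ⟨q, hq⟩
    · refine ⟨p, ht hp, fun v hv => ?_⟩
      by_contra hne
      exact Finset.notMem_empty v (he ▸ Finset.mem_erase.2 ⟨fun h => hne (.inl h), hv⟩)
    · refine ⟨q, ht (Finset.mem_of_mem_erase hq), fun v hv => or_iff_not_imp_left.2 fun hne => ?_⟩
      exact Finset.card_le_one.1 hcard' v (Finset.mem_erase.2 ⟨hne, hv⟩) q hq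
  exact Set.mem_biUnion (ht hp) (Set.mem_biUnion hq
    (convexHull_subset_affineSpan _ (convexHull_mono htpq hx)))

theorem isTriangle_of_generic (ht : t ⊆ S) (hind : AffineIndependent ℝ ((↑) : t → Plane))
    (hx : x ∈ convexHull ℝ (t : Set Plane)) (hxS : x ∉ lineUnion S) : IsTriangle t := by
  refine ⟨le_antisymm ?_ (not_lt.1 fun h => hxS (hull_subset_lineUnion ht (by omega) hx)), hind⟩
  have hcard := hind.card_le_finrank_succ
  have hrank := Submodule.finrank_le (vectorSpan ℝ (Set.range ((↑) : t → Plane)))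
  rw [finrank_euclideanSpace_fin] at hrank
  rw [Fintype.card_coe] at hcard
  omega

theorem exists_triangle_of_generic (ht : t ⊆ S) (hx : x ∈ convexHull ℝ (t : Set Plane))
    (hxS : x ∉ lineUnion S) : ∃ T ⊆ t, IsTriangle T ∧ x ∈ convexHull ℝ (T : Set Plane) := by
  rw [convexHull_eq_union] at hx
  simp only [Set.mem_iUnion] at hx
  obtain ⟨T, hTt, hind, hxT⟩ := hx
  exact ⟨T, hTt, isTriangle_of_generic (hTt.trans ht) hind hxT hxS, hxT⟩

theorem coord_pos_of_generic {B : AffineBasis (Fin 3) ℝ Plane} (hT : T ⊆ S)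
    (hB : (T : Set Plane) = Set.range B) (hx : x ∈ convexHull ℝ (T : Set Plane))
    (hxS : x ∉ lineUnion S) (i : Fin 3) : 0 < B.coord i x := by
  classical
  have hnonneg := (mem_hull_iff hB).1 hx
  by_contra! hi
  refine hxS (hull_subset_lineUnion (t := (Finset.univ.erase i).image B) ?_ ?_ ?_)
  · exact Finset.image_subset_iff.2 fun j _ => hT (basis_mem hB j)
  · exact Finset.card_image_le.trans (by simp)
  · refine convexHull_mono ?_ (mem_convexHull_image_coord_pos hnonneg)
    rintro _ ⟨j, hj, rfl⟩
    exact Finset.mem_image_of_mem B (Finset.mem_erase.2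
      ⟨fun h => hi.not_gt (h ▸ hj), Finset.mem_univ j⟩)

theorem isClosed_biUnion_hull (F : Finset (Finset Plane)) :
    IsClosed (⋃ T ∈ F, convexHull ℝ (T : Set Plane)) :=
  F.finite_toSet.isClosed_biUnion fun T _ => (T.finite_toSet.isCompact_convexHull ℝ).isClosed

theorem hull_subset_of_generic {F : Finset (Finset Plane)}
    (hi : (interior (convexHull ℝ (S : Set Plane))).Nonempty)
    (h : ∀ x ∈ convexHull ℝ (S : Set Plane), x ∉ lineUnion S →
      ∃ T ∈ F, x ∈ convexHull ℝ (T : Set Plane)) :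
    convexHull ℝ (S : Set Plane) ⊆ ⋃ T ∈ F, convexHull ℝ (T : Set Plane) := by
  refine subset_of_measure_sdiff_eq_zero (convex_convexHull ℝ _) hi (isClosed_biUnion_hull F)
    (measure_mono_null ?_ (volume_lineUnion S))
  rintro x ⟨hx, hxF⟩
  by_contra hxS
  obtain ⟨T, hT, hxT⟩ := h x hx hxS
  exact hxF (Set.mem_biUnion hT hxT)

end Generic

section DelaunayCover

variable {S T : Finset Plane} {x : Plane}

theorem IsTriangle.exists_sphere (hT : IsTriangle T) :
    ∃ s : EuclideanGeometry.Sphere Plane, ∀ v ∈ T, v ∈ s := by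
  have := hT.nonempty.to_subtype
  obtain ⟨s, ⟨-, hs⟩, -⟩ := hT.2.existsUnique_dist_eq
  exact ⟨s, fun v hv => hs ⟨⟨v, hv⟩, rfl⟩⟩

theorem exists_triangle_power_lt (hTS : T ⊆ S) (hT : IsTriangle T)
    (hx : x ∈ convexHull ℝ (T : Set Plane)) (hxS : x ∉ lineUnion S)
    {s : EuclideanGeometry.Sphere Plane} (hs : ∀ v ∈ T, v ∈ s) {p : Plane} (hp : p ∈ S)
    (hps : s.power p < 0) :
    ∃ T' ⊆ S, IsTriangle T' ∧ x ∈ convexHull ℝ (T' : Set Plane) ∧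
      ∀ s' : EuclideanGeometry.Sphere Plane, (∀ v ∈ T', v ∈ s') → s.power x < s'.power x := by
  classical
  obtain ⟨B, hB, -⟩ := hT.exists_basis hT.nonempty.choose_spec
  have hpos := coord_pos_of_generic hTS hB hx hxS
  obtain ⟨i, hip, hxi⟩ := exists_mem_convexHull_range_update hpos p
  set U : Finset Plane := Finset.univ.image (Function.update B i p) with hU
  have hUS : U ⊆ S := by
    refine Finset.image_subset_iff.2 fun j _ => ?_
    rcases eq_or_ne j i with rfl | hj
    · rwa [Function.update_self]
    · rw [Function.update_of_ne hj]
      exact hTS (basis_mem hB j)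
  have hxU : x ∈ convexHull ℝ (U : Set Plane) := by
    rwa [hU, Finset.coe_image, Finset.coe_univ, Set.image_univ]
  obtain ⟨T', hT'U, hT', hxT'⟩ := exists_triangle_of_generic hUS hxU hxS
  have hT'_eq : T' = U := Finset.eq_of_subset_of_card_le hT'U
    (Finset.card_image_le.trans_eq (by rw [hT'.1, Finset.card_univ, Fintype.card_fin]))
  refine ⟨T', hT'U.trans hUS, hT', hxT', fun s' hs' => ?_⟩
  have hs'_update (j : Fin 3) : Function.update B i p j ∈ s' :=
    hs' _ (hT'_eq ▸ Finset.mem_image_of_mem _ (Finset.mem_univ j))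
  have hdiff (y : Plane) : powerDiff s' s y = B.coord i y * powerDiff s' s (B i) := by
    rw [affineMap_apply_eq_sum_coord B]
    refine Finset.sum_eq_single i (fun j _ hj => ?_) (fun hi => (hi (Finset.mem_univ i)).elim)
    have hj' := hs'_update j
    rw [Function.update_of_ne hj] at hj'
    rw [powerDiff_apply, power_eq_zero_of_mem hj', power_eq_zero_of_mem (hs _ (basis_mem hB j)),
      sub_zero, mul_zero]
  have hp_pos : 0 < powerDiff s' s p := by
    have := hs'_update i
    rw [Function.update_self] at this
    rw [powerDiff_apply, power_eq_zero_of_mem this, zero_sub]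
    exact neg_pos.2 hps
  rw [hdiff] at hp_pos
  have hx_pos : 0 < powerDiff s' s x := by
    rw [hdiff]
    exact mul_pos (hpos i) (pos_of_mul_pos_right hp_pos hip.le)
  rwa [powerDiff_apply, sub_pos] at hx_pos

-- Among the triangles containing `x`, one whose circumcircle maximizes the power of `x` is
-- Delaunay.
open Classical in
theorem exists_mem_delaunay_of_generic (hx : x ∈ convexHull ℝ (S : Set Plane))
    (hxS : x ∉ lineUnion S) : ∃ T ∈ delaunay S, x ∈ convexHull ℝ (T : Set Plane) := by
  choose! s hs using fun (T : Finset Plane) (hT : IsTriangle T) => hT.exists_sphere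
  obtain ⟨T₀, hT₀⟩ := exists_triangle_of_generic (Finset.Subset.refl S) hx hxS
  have hne : {T ∈ S.powerset | IsTriangle T ∧ x ∈ convexHull ℝ (T : Set Plane)}.Nonempty :=
    ⟨T₀, by simpa using hT₀⟩
  obtain ⟨T, hT, hmax⟩ := Finset.exists_max_image _ (fun T => (s T).power x) hne
  simp only [Finset.mem_filter, Finset.mem_powerset] at hT hmax
  obtain ⟨hTS, hT, hxT⟩ := hT
  refine ⟨T, mem_delaunay_iff.2 ⟨hTS, hT, s T, hs T hT, fun p hp => ?_⟩, hxT⟩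
  by_contra! hps
  obtain ⟨T', hT'S, hT', hxT', hlt⟩ := exists_triangle_power_lt hTS hT hxT hxS (hs T hT) hp hps
  exact (hmax T' ⟨hT'S, hT', hxT'⟩).not_gt (hlt _ (hs T' hT'))

theorem hull_subset_delaunay (hi : (interior (convexHull ℝ (S : Set Plane))).Nonempty) :
    convexHull ℝ (S : Set Plane) ⊆ ⋃ T ∈ delaunay S, convexHull ℝ (T : Set Plane) :=
  hull_subset_of_generic hi fun _ => exists_mem_delaunay_of_generic

end DelaunayCover

section Complex

variable {S t T : Finset Plane} {K : Geometry.SimplicialComplex ℝ Plane} {v : Plane}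

open Classical in
theorem mem_triangles : T ∈ triangles S K ↔ (T ⊆ S ∧ T.card = 3) ∧ T ∈ K.faces := by
  rw [triangles, Finset.mem_filter, Finset.mem_powersetCard]

theorem isTriangle_of_mem_triangles (hT : T ∈ triangles S K) : IsTriangle T :=
  ⟨(mem_triangles.1 hT).1.2, K.indep (mem_triangles.1 hT).2⟩

theorem IsGeometricTriangulation.subset_of_mem_faces (hK : IsGeometricTriangulation S K)
    (ht : t ∈ K.faces) : t ⊆ S := by
  intro v hv
  rw [← Finset.mem_coe, ← hK.vertices_eq, K.vertices_eq]
  exact Set.mem_biUnion ht hv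

theorem IsGeometricTriangulation.mem_of_mem_hull (hK : IsGeometricTriangulation S K)
    (hT : T ∈ triangles S K) (hv : v ∈ S) (hvT : v ∈ convexHull ℝ (T : Set Plane)) : v ∈ T := by
  rw [← Finset.mem_coe, ← hK.vertices_eq] at hv
  exact (Geometry.SimplicialComplex.vertex_mem_convexHull_iff hv (mem_triangles.1 hT).2).1 hvT

theorem IsGeometricTriangulation.hull_subset (hK : IsGeometricTriangulation S K)
    (hi : (interior (convexHull ℝ (S : Set Plane))).Nonempty) :
    convexHull ℝ (S : Set Plane) ⊆ ⋃ T ∈ triangles S K, convexHull ℝ (T : Set Plane) := by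
  refine hull_subset_of_generic hi fun x hx hxS => ?_
  rw [← hK.space_eq, Geometry.SimplicialComplex.mem_space_iff] at hx
  obtain ⟨t, ht, hxt⟩ := hx
  have htS := hK.subset_of_mem_faces ht
  have hT := isTriangle_of_generic htS (K.indep ht) hxt hxS
  exact ⟨t, mem_triangles.2 ⟨⟨htS, hT.1⟩, ht⟩, hxt⟩

end Complex

theorem exists_last_exit {ι X : Type*} [TopologicalSpace X] {γ : ℝ → X} (hγ : Continuous γ)
    {A : Set X} (hA : IsClosed A) {F : Finset ι} {U : ι → Set X} (hU : ∀ i ∈ F, IsClosed (U i))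
    (hcover : ∀ t ∈ Set.Icc (0 : ℝ) 1, γ t ∈ A ∪ ⋃ i ∈ F, U i) (h0 : γ 0 ∈ A) (h1 : γ 1 ∉ A) :
    ∃ t ∈ Set.Icc (0 : ℝ) 1, γ t ∈ A ∧ ∃ i ∈ F, γ t ∈ U i ∧ ∃ τ > t, γ τ ∈ U i ∧ γ τ ∉ A := by
  have hcompact : IsCompact (Set.Icc (0 : ℝ) 1 ∩ γ ⁻¹' A) :=
    isCompact_Icc.inter_right (hA.preimage hγ)
  obtain ⟨t, ⟨ht, htA⟩, hmax⟩ := hcompact.exists_isGreatest ⟨0, by simp, h0⟩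
  have ht1 : t < 1 := lt_of_le_of_ne ht.2 fun h => h1 (h ▸ htA)
  have hexit {τ : ℝ} (hτ : τ ∈ Set.Ioc t 1) : γ τ ∉ A := fun hτA =>
    (hmax ⟨⟨ht.1.trans hτ.1.le, hτ.2⟩, hτA⟩).not_gt hτ.1
  have hsub : Set.Ioc t 1 ⊆ ⋃ i ∈ F, Set.Ioc t 1 ∩ γ ⁻¹' U i := fun τ hτ => by
    have := (hcover τ ⟨ht.1.trans hτ.1.le, hτ.2⟩).resolve_left (hexit hτ)
    simpa [hτ.1, hτ.2] using this
  have htcl : t ∈ closure (Set.Ioc t 1) := by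
    rw [closure_Ioc ht1.ne]
    exact Set.left_mem_Icc.2 ht1.le
  have htcl' := closure_mono hsub htcl
  rw [F.closure_biUnion] at htcl'
  obtain ⟨i, hi, hti⟩ := Set.mem_iUnion₂.1 htcl'
  obtain ⟨τ, hτ, hτi⟩ := closure_nonempty_iff.1 ⟨t, hti⟩
  exact ⟨t, ht, htA, i, hi, closure_minimal Set.inter_subset_right ((hU i hi).preimage hγ) hti,
    τ, hτ.1, hτi, hexit hτ⟩

section Exit

variable {S T T₀ T₁ : Finset Plane} {K : Geometry.SimplicialComplex ℝ Plane}
  {B : AffineBasis (Fin 3) ℝ Plane} {s x y z : Plane} {ρ : ℝ}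

theorem coord_eq_zero_of_mem_hull_inter (hT : T ∈ triangles S K) (hT₁ : T₁ ∈ triangles S K)
    (hB : (T : Set Plane) = Set.range B) (hy : y ∈ convexHull ℝ (T : Set Plane))
    (hy₁ : y ∈ convexHull ℝ (T₁ : Set Plane)) {i : Fin 3} (hi : B i ∉ T₁) : B.coord i y = 0 := by
  have hsub : (T ∩ T₁ : Set Plane) ⊆ B.coord i ⁻¹' {0} := by
    rintro v ⟨hvT, hvT₁⟩
    obtain ⟨j, rfl⟩ := (mem_iff_exists_eq hB).1 hvT
    exact B.coord_apply_ne fun h => hi (h ▸ hvT₁)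
  exact convexHull_min hsub ((convex_singleton 0).affine_preimage _)
    (K.inter_subset_convexHull (mem_triangles.1 hT).2 (mem_triangles.1 hT₁).2 ⟨hy, hy₁⟩)

theorem IsGeometricTriangulation.exists_cutsEdge_of_mem_hull_inter
    (hK : IsGeometricTriangulation S K) (hT : T ∈ triangles S K) (hT₁ : T₁ ∈ triangles S K)
    (hs : s ∈ T) (hsx : dist s x ≤ ρ) (hfar : ∀ v ∈ T₁, ρ < dist v x)
    (hyx : y ∈ Metric.closedBall x ρ) (hy : y ∈ convexHull ℝ (T : Set Plane))
    (hy₁ : y ∈ convexHull ℝ (T₁ : Set Plane)) :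
    ∃ B : AffineBasis (Fin 3) ℝ Plane, (T : Set Plane) = Set.range B ∧ CutsEdge B x ρ y ∧
      ∀ i ≠ 2, B i ∈ T₁ := by
  obtain ⟨B, hB, rfl⟩ := (isTriangle_of_mem_triangles hT).exists_basis hs
  have hzero {i : Fin 3} (hi : B i ∉ T₁) : B.coord i y = 0 :=
    coord_eq_zero_of_mem_hull_inter hT hT₁ hB hy hy₁ hi
  have hy2 : B.coord 2 y = 0 := hzero fun h => (hfar _ h).not_ge hsx
  have hmem (i : Fin 3) (hi : i ≠ 2) : B i ∈ T₁ := by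
    by_contra hiT₁
    obtain ⟨j, hj⟩ : ∃ j, ∀ k ≠ j, k = i ∨ k = 2 := by
      clear hiT₁
      revert i
      decide
    have hyj : y = B j := eq_basis_of_forall_coord_eq_zero B fun k hk => by
      rcases hj k hk with rfl | rfl
      exacts [hzero hiT₁, hy2]
    rw [hyj] at hy₁ hyx
    have hjS : B j ∈ S := (mem_triangles.1 hT).1.1 (basis_mem hB j)
    exact (hfar _ (hK.mem_of_mem_hull hT₁ hjS hy₁)).not_ge hyx
  exact ⟨B, hB, ⟨hsx, fun i hi => hfar _ (hmem i hi), hyx, hy2, (mem_hull_iff hB).1 hy⟩, hmem⟩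

open Classical in
theorem IsGeometricTriangulation.exists_exit_segment (hK : IsGeometricTriangulation S K)
    (hi : (interior (convexHull ℝ (S : Set Plane))).Nonempty) (hT₀ : T₀ ∈ triangles S K)
    (hfar : ∀ v ∈ T₀, ρ < dist v x) (hy : y ∈ convexHull ℝ (T₀ : Set Plane)) (hs : s ∈ S)
    (hsx : dist s x ≤ ρ) :
    ∃ t ∈ Set.Icc (0 : ℝ) 1, ∃ T₁ ∈ triangles S K, ∃ T ∈ triangles S K, ∃ τ > t,
      (∀ v ∈ T₁, ρ < dist v x) ∧ (∃ v ∈ T, dist v x ≤ ρ) ∧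
      AffineMap.lineMap y s t ∈ convexHull ℝ (T₁ : Set Plane) ∧
      AffineMap.lineMap y s t ∈ convexHull ℝ (T : Set Plane) ∧
      AffineMap.lineMap y s τ ∈ convexHull ℝ (T : Set Plane) ∧
      AffineMap.lineMap y s τ ∉ convexHull ℝ (T₁ : Set Plane) := by
  set far := {T ∈ triangles S K | ∀ v ∈ T, ρ < dist v x}
  set near := {T ∈ triangles S K | ∃ v ∈ T, dist v x ≤ ρ}
  have hT₀S : convexHull ℝ (T₀ : Set Plane) ⊆ convexHull ℝ (S : Set Plane) :=
    convexHull_mono (mem_triangles.1 hT₀).1.1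
  have hcover (t : ℝ) (ht : t ∈ Set.Icc (0 : ℝ) 1) : AffineMap.lineMap y s t ∈
      (⋃ T ∈ far, convexHull ℝ (T : Set Plane)) ∪ ⋃ T ∈ near, convexHull ℝ (T : Set Plane) := by
    have hmem : AffineMap.lineMap y s t ∈ convexHull ℝ (S : Set Plane) :=
      (convex_convexHull ℝ _).lineMap_mem (hT₀S hy) (subset_convexHull ℝ _ hs) ht
    obtain ⟨T, hT, hmemT⟩ := Set.mem_iUnion₂.1 (hK.hull_subset hi hmem)
    by_cases hTfar : ∀ v ∈ T, ρ < dist v x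
    · exact .inl (Set.mem_biUnion (Finset.mem_filter.2 ⟨hT, hTfar⟩) hmemT)
    · push Not at hTfar
      exact .inr (Set.mem_biUnion (Finset.mem_filter.2 ⟨hT, hTfar⟩) hmemT)
  have hs_notMem : AffineMap.lineMap y s (1 : ℝ) ∉ ⋃ T ∈ far, convexHull ℝ (T : Set Plane) := by
    rw [AffineMap.lineMap_apply_one, Set.mem_iUnion₂]
    rintro ⟨T, hT, hsT⟩
    rw [Finset.mem_filter] at hT
    exact (hT.2 s (hK.mem_of_mem_hull hT.1 hs hsT)).not_ge hsx
  obtain ⟨t, ht, htfar, T, hT, htT, τ, hτ, hτT, hτfar⟩ := exists_last_exit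
    AffineMap.lineMap_continuous (isClosed_biUnion_hull far)
    (fun T _ => (T.finite_toSet.isCompact_convexHull ℝ).isClosed) hcover
    (Set.mem_biUnion (Finset.mem_filter.2 ⟨hT₀, hfar⟩) (by rwa [AffineMap.lineMap_apply_zero]))
    hs_notMem
  obtain ⟨T₁, hT₁, htT₁⟩ := Set.mem_iUnion₂.1 htfar
  have hτT₁ := fun h => hτfar (Set.mem_biUnion hT₁ h)
  rw [Finset.mem_filter] at hT hT₁
  exact ⟨t, ht, T₁, hT₁.1, T, hT.1, τ, hτ, hT₁.2, hT.2, htT₁, htT, hτT, hτT₁⟩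

theorem IsGeometricTriangulation.exists_cutsEdge_of_far (hK : IsGeometricTriangulation S K)
    (hi : (interior (convexHull ℝ (S : Set Plane))).Nonempty) (hT₀ : T₀ ∈ triangles S K)
    (hfar : ∀ v ∈ T₀, ρ < dist v x) (hy : y ∈ convexHull ℝ (T₀ : Set Plane))
    (hyx : y ∈ Metric.closedBall x ρ) (hs : s ∈ S) (hsx : dist s x ≤ ρ) :
    ∃ T ∈ triangles S K, ∃ T₁ ∈ triangles S K, T ≠ T₁ ∧
      ∃ B : AffineBasis (Fin 3) ℝ Plane, (T : Set Plane) = Set.range B ∧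
      ∃ z ∈ convexHull ℝ (T : Set Plane) ∩ convexHull ℝ (T₁ : Set Plane), CutsEdge B x ρ z ∧
      (B.coord 2 y < 0 ∨ y = z) := by
  obtain ⟨t, ht, T₁, hT₁, T, hT, τ, hτ, hT₁far, ⟨v, hv, hvx⟩, htT₁, htT, hτT, hτT₁⟩ :=
    hK.exists_exit_segment hi hT₀ hfar hy hs hsx
  obtain ⟨B, hB, hcuts, hBT₁⟩ := hK.exists_cutsEdge_of_mem_hull_inter hT hT₁ hv hvx hT₁far
    ((convex_closedBall x ρ).lineMap_mem hyx hsx ht) htT htT₁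
  have hτnonneg := (mem_hull_iff hB).1 hτT
  have hτpos : 0 < B.coord 2 (AffineMap.lineMap y s τ) := by
    refine (hτnonneg 2).lt_of_ne' fun h => hτT₁ ?_
    refine convexHull_mono ?_ (mem_convexHull_image_coord_pos hτnonneg)
    rintro _ ⟨i, hi, rfl⟩
    refine hBT₁ i ?_
    rintro rfl
    exact hi.ne' h
  have hzero := hcuts.coord_eq_zero
  rw [AffineMap.apply_lineMap, AffineMap.lineMap_apply_ring'] at hτpos hzero
  have hslope : 0 < B.coord 2 s - B.coord 2 y := by nlinarith
  refine ⟨T, hT, T₁, hT₁, ?_, B, hB, _, ⟨htT, htT₁⟩, hcuts, ?_⟩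
  · rintro rfl
    exact (hT₁far v hv).not_ge hvx
  · rcases ht.1.eq_or_lt with rfl | ht0
    · exact .inr (AffineMap.lineMap_apply_zero y s).symm
    · exact .inl (by nlinarith [hslope])

theorem IsGeometricTriangulation.exists_hidesVertex_of_far (hK : IsGeometricTriangulation S K)
    (hi : (interior (convexHull ℝ (S : Set Plane))).Nonempty) (hT₀ : T₀ ∈ triangles S K)
    (hfar : ∀ v ∈ T₀, ρ < dist v x) (hx : x ∈ convexHull ℝ (T₀ : Set Plane))
    (huniq : ∀ T ∈ triangles S K, ∀ T' ∈ triangles S K, T ≠ T' →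
      x ∈ convexHull ℝ (T : Set Plane) → x ∉ convexHull ℝ (T' : Set Plane))
    (hs : s ∈ S) (hsx : dist s x ≤ ρ) : ∃ T ∈ triangles S K, HidesVertex T x ρ := by
  obtain ⟨T, hT, T₁, hT₁, hne, B, hB, z, ⟨hzT, hzT₁⟩, hcuts, hneg | rfl⟩ :=
    hK.exists_cutsEdge_of_far hi hT₀ hfar hx (Metric.mem_closedBall_self (dist_nonneg.trans hsx))
      hs hsx
  · exact ⟨T, hT, B, hB, hcuts.hides hneg⟩
  · exact (huniq T hT T₁ hT₁ hne hzT hzT₁).elim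

end Exit

section Outside

theorem exists_affineMap_nearest_point {V : Type*} [NormedAddCommGroup V] [InnerProductSpace ℝ V]
    {C : Set V} {x : V} (hne : C.Nonempty) (hC : IsComplete C) (hconv : Convex ℝ C) (hx : x ∉ C) :
    ∃ y ∈ C, (∀ z ∈ C, dist y x ≤ dist z x) ∧
      ∃ f : V →ᵃ[ℝ] ℝ, f y = 0 ∧ (∀ z ∈ C, f z ≤ 0) ∧ 0 < f x := by
  obtain ⟨y, hy, hmin⟩ := exists_norm_eq_iInf_of_complete_convex hne hC hconv x
  have hinner := (norm_eq_iInf_iff_real_inner_le_zero hconv hy).1 hmin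
  refine ⟨y, hy, fun z hz => ?_,
    (innerₗ V (x - y)).toAffineMap - AffineMap.const ℝ V (inner ℝ (x - y) y), ?_⟩
  · rw [dist_comm, dist_comm z, dist_eq_norm, dist_eq_norm, hmin]
    exact ciInf_le ⟨0, by rintro _ ⟨w, rfl⟩; exact norm_nonneg _⟩ (⟨z, hz⟩ : C)
  · simp only [AffineMap.coe_sub, Pi.sub_apply, LinearMap.coe_toAffineMap, innerₗ_apply_apply,
      AffineMap.const_apply, ← inner_sub_right]
    refine ⟨by rw [sub_self, inner_zero_right], hinner, real_inner_self_pos.2 ?_⟩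
    exact sub_ne_zero.2 fun h => hx (h ▸ hy)

variable {S T : Finset Plane} {K : Geometry.SimplicialComplex ℝ Plane}
  {B : AffineBasis (Fin 3) ℝ Plane} {v w x y z : Plane} {f : Plane →ᵃ[ℝ] ℝ} {ρ : ℝ}

theorem CutsEdge.coord_neg (h : CutsEdge B x ρ z) (hyx : y ∈ Metric.closedBall x ρ)
    (hy2 : B.coord 2 y ≤ 0) (hfy : f y = 0) (hfB : ∀ i, f (B i) ≤ 0) (hfx : 0 < f x) :
    B.coord 2 x < 0 := by
  by_contra! hx2
  have hxx : x ∈ Metric.closedBall x ρ := Metric.mem_closedBall_self (dist_nonneg.trans h.dist_le)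
  have hpos {w : Plane} (hw : w ∈ Metric.closedBall x ρ) (hw2 : B.coord 2 w = 0) {i : Fin 3}
      (hi : i ≠ 2) : 0 < B.coord i w :=
    coord_pos_of_mem_closedBall h.lt_dist h.mem_closedBall hw h.coord_eq_zero hw2
      (h.coord_nonneg i) hi
  have hsum {w : Plane} (hw2 : B.coord 2 w = 0) :
      f w = B.coord 0 w * f (B 0) + B.coord 1 w * f (B 1) := by
    rw [affineMap_apply_eq_sum_coord B, Fin.sum_univ_three, hw2, zero_mul, add_zero]
  rcases hx2.eq_or_lt with hx2 | hx2
  · have h0 := mul_nonpos_of_nonneg_of_nonpos (hpos hxx hx2.symm (i := 0) (by decide)).le (hfB 0)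
    have h1 := mul_nonpos_of_nonneg_of_nonpos (hpos hxx hx2.symm (i := 1) (by decide)).le (hfB 1)
    linarith [hsum hx2.symm]
  · obtain ⟨t, ht, ht2⟩ := exists_lineMap_eq_zero hy2 hx2
    have hw := (convex_closedBall x ρ).lineMap_mem hyx hxx ⟨ht.1, ht.2.le⟩
    have hfw : f (AffineMap.lineMap y x t) = t * f x := by
      rw [AffineMap.apply_lineMap, AffineMap.lineMap_apply_ring, hfy, mul_zero, zero_add]
    have h0 := hpos hw ht2 (i := 0) (by decide)
    have h1 := hpos hw ht2 (i := 1) (by decide)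
    have hge : 0 ≤ f (AffineMap.lineMap y x t) := hfw ▸ mul_nonneg ht.1 hfx.le
    rw [hsum ht2] at hge
    have hf0 : f (B 0) = 0 := by nlinarith [hfB 0, mul_nonpos_of_nonneg_of_nonpos h1.le (hfB 1)]
    have hf1 : f (B 1) = 0 := by nlinarith [hfB 1, mul_nonpos_of_nonneg_of_nonpos h0.le (hfB 0)]
    rw [affineMap_apply_eq_sum_coord B, Fin.sum_univ_three, hf0, hf1] at hfx
    linarith [mul_nonpos_of_nonneg_of_nonpos hx2.le (hfB 2)]

theorem IsTriangle.exists_cutsEdge_of_affineMap (hT : IsTriangle T) (hv : v ∈ T)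
    (hvx : dist v x ≤ ρ) (hf : ∀ w ∈ T, f w ≤ 0) (hneg : ∀ w ∈ T, dist w x ≤ ρ → f w < 0)
    (hy : y ∈ convexHull ℝ (T : Set Plane)) (hyx : y ∈ Metric.closedBall x ρ) (hfy : f y = 0) :
    ∃ B : AffineBasis (Fin 3) ℝ Plane, (T : Set Plane) = Set.range B ∧ CutsEdge B x ρ y := by
  obtain ⟨B, hB, rfl⟩ := hT.exists_basis hv
  have hynonneg := (mem_hull_iff hB).1 hy
  have hzero {i : Fin 3} (hi : f (B i) < 0) : B.coord i y = 0 := by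
    rw [affineMap_apply_eq_sum_coord B, Finset.sum_eq_zero_iff_of_nonpos fun j _ =>
      mul_nonpos_of_nonneg_of_nonpos (hynonneg j) (hf _ (basis_mem hB j))] at hfy
    exact (mul_eq_zero.1 (hfy i (Finset.mem_univ i))).resolve_right hi.ne
  have hy2 : B.coord 2 y = 0 := hzero (hneg _ (basis_mem hB 2) hvx)
  refine ⟨B, hB, hvx, fun i hi => ?_, hyx, hy2, hynonneg⟩
  by_contra! hix
  obtain ⟨j, hj⟩ : ∃ j, ∀ k ≠ j, k = i ∨ k = 2 := by
    clear hix
    revert i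
    decide
  have hyj : y = B j := eq_basis_of_forall_coord_eq_zero B fun k hk => by
    rcases hj k hk with rfl | rfl
    exacts [hzero (hneg _ (basis_mem hB k) hix), hy2]
  exact (hneg _ (basis_mem hB j) (hyj ▸ hyx)).ne (hyj ▸ hfy)

theorem HidesVertex.affineMap_neg (h : HidesVertex T x ρ) (hT : T ∈ delaunay S)
    (hf : ∀ p ∈ S, f p ≤ 0) (hfx : 0 < f x) (hw : w ∈ S) (hwx : dist w x ≤ ρ) : f w < 0 := by
  obtain ⟨B, hB, h⟩ := h
  obtain ⟨hTS, -, s, hs, hsS⟩ := mem_delaunay_iff.1 hT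
  by_contra! hfw
  have hzero := h.affineMap_eq_zero hwx
    (h.coord_pos_of_power_nonneg (fun i => hs _ (basis_mem hB i)) hwx (hsS w hw))
    (fun i _ => hf _ (hTS (basis_mem hB i))) hfx.le hfw
  refine hfx.ne' ?_
  rw [affineMap_apply_eq_sum_coord B]
  exact Finset.sum_eq_zero fun i _ => by rw [hzero, mul_zero]

theorem IsGeometricTriangulation.exists_hidesVertex_of_delaunay
    (hK : IsGeometricTriangulation S K)
    (hi : (interior (convexHull ℝ (S : Set Plane))).Nonempty)
    (hx : x ∉ convexHull ℝ (S : Set Plane)) (hT : T ∈ delaunay S) (h : HidesVertex T x ρ) :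
    ∃ T' ∈ triangles S K, HidesVertex T' x ρ := by
  obtain ⟨r, hr, hrx⟩ : ∃ r ∈ S, dist r x ≤ ρ := by
    obtain ⟨B, hB, hB2⟩ := h
    exact ⟨B 2, (mem_delaunay_iff.1 hT).1 (basis_mem hB 2), hB2.dist_le⟩
  obtain ⟨y, hy, hmin, f, hfy, hf, hfx⟩ := exists_affineMap_nearest_point
    (hi.mono interior_subset) (S.finite_toSet.isCompact_convexHull ℝ).isComplete
    (convex_convexHull ℝ _) hx
  have hfS (p : Plane) (hp : p ∈ S) : f p ≤ 0 := hf p (subset_convexHull ℝ _ hp)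
  have hyx : y ∈ Metric.closedBall x ρ := (hmin r (subset_convexHull ℝ _ hr)).trans hrx
  suffices ∃ T' ∈ triangles S K, ∃ B : AffineBasis (Fin 3) ℝ Plane, (T' : Set Plane) = Set.range B ∧
      ∃ z, CutsEdge B x ρ z ∧ B.coord 2 y ≤ 0 by
    obtain ⟨T', hT', B, hB, z, hcuts, hy2⟩ := this
    exact ⟨T', hT', B, hB, hcuts.hides (hcuts.coord_neg hyx hy2 hfy
      (fun i => hfS _ ((mem_triangles.1 hT').1.1 (basis_mem hB i))) hfx)⟩
  obtain ⟨T', hT', hyT'⟩ := Set.mem_iUnion₂.1 (hK.hull_subset hi hy)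
  have hT'S : T' ⊆ S := (mem_triangles.1 hT').1.1
  by_cases hfar : ∀ v ∈ T', ρ < dist v x
  · obtain ⟨T₂, hT₂, -, -, -, B, hB, z, -, hcuts, hy2⟩ :=
      hK.exists_cutsEdge_of_far hi hT' hfar hyT' hyx hr hrx
    exact ⟨T₂, hT₂, B, hB, z, hcuts, hy2.elim le_of_lt fun hyz => hyz ▸ hcuts.coord_eq_zero.le⟩
  · push Not at hfar
    obtain ⟨v, hv, hvx⟩ := hfar
    obtain ⟨B, hB, hcuts⟩ := (isTriangle_of_mem_triangles hT').exists_cutsEdge_of_affineMap hv hvx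
      (fun w hw => hfS w (hT'S hw)) (fun w hw => h.affineMap_neg hT hfS hfx (hT'S hw)) hyT' hyx hfy
    exact ⟨T', hT', B, hB, y, hcuts, hcuts.coord_eq_zero.le⟩

end Outside

/-! ### The local inequality -/

section HiddenRadii

variable {Δ : Finset Plane} {x : Plane} {t : ℝ}

theorem localTriangle_of_mem_hull (hx : x ∈ convexHull ℝ (Δ : Set Plane)) :
    localTriangle Δ x = Metric.infDist x (Δ : Set Plane) ^ 2 := by
  have hvis : visibleVertices Δ x ⊆ {x} := fun v hv => by
    have hxv : x ∈ segment ℝ x v ∩ convexHull ℝ (Δ : Set Plane) := ⟨left_mem_segment ℝ x v, hx⟩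
    rw [hv.2] at hxv
    exact hxv.symm
  have hzero : Metric.infDist x (visibleVertices Δ x) = 0 := by
    rcases Set.subset_singleton_iff_eq.1 hvis with h | h <;> rw [h]
    exacts [Metric.infDist_empty, by rw [Metric.infDist_singleton, dist_self]]
  rw [localTriangle, hzero, zero_pow two_ne_zero, sub_zero]

/-- The squares `t` of the radii at which a vertex of `Δ` is hidden from `x` in the sense of
`HidesVertex`. Outside the closed triangle they fill an interval of length `-localTriangle Δ x`. -/
def hiddenRadiiSq (Δ : Finset Plane) (x : Plane) : Set ℝ :=
  {t | 0 ≤ t ∧ HidesVertex Δ x √t}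

theorem hiddenRadiiSq_of_mem_hull (hx : x ∈ convexHull ℝ (Δ : Set Plane)) :
    hiddenRadiiSq Δ x = ∅ := by
  refine Set.eq_empty_of_forall_notMem ?_
  rintro t ⟨-, B, hB, h⟩
  exact h.notMem_hull hB hx

theorem IsTriangle.hiddenRadiiSq_of_notMem_hull (hT : IsTriangle Δ)
    (hx : x ∉ convexHull ℝ (Δ : Set Plane)) : hiddenRadiiSq Δ x =
      Set.Ico (Metric.infDist x Δ ^ 2) (Metric.infDist x (visibleVertices Δ x) ^ 2) := by
  ext t
  rw [hiddenRadiiSq, Set.mem_ofPred_eq, hidesVertex_iff hT hx, Set.mem_Ico]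
  constructor
  · rintro ⟨ht, hle, hlt⟩
    exact ⟨(Real.le_sqrt Metric.infDist_nonneg ht).1 hle,
      (Real.sqrt_lt ht Metric.infDist_nonneg).1 hlt⟩
  · rintro ⟨hle, hlt⟩
    have ht : 0 ≤ t := (sq_nonneg _).trans hle
    exact ⟨ht, (Real.le_sqrt Metric.infDist_nonneg ht).2 hle,
      (Real.sqrt_lt ht Metric.infDist_nonneg).2 hlt⟩

theorem IsTriangle.measurableSet_hiddenRadiiSq (hT : IsTriangle Δ) (x : Plane) :
    MeasurableSet (hiddenRadiiSq Δ x) := by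
  by_cases hx : x ∈ convexHull ℝ (Δ : Set Plane)
  · rw [hiddenRadiiSq_of_mem_hull hx]
    exact MeasurableSet.empty
  · rw [hT.hiddenRadiiSq_of_notMem_hull hx]
    exact measurableSet_Ico

theorem IsTriangle.volume_hiddenRadiiSq_ne_top (hT : IsTriangle Δ) (x : Plane) :
    volume (hiddenRadiiSq Δ x) ≠ ⊤ := by
  by_cases hx : x ∈ convexHull ℝ (Δ : Set Plane)
  · rw [hiddenRadiiSq_of_mem_hull hx, measure_empty]
    exact ENNReal.zero_ne_top
  · rw [hT.hiddenRadiiSq_of_notMem_hull hx]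
    exact measure_Ico_lt_top.ne

theorem IsTriangle.localTriangle_eq (hT : IsTriangle Δ) (x : Plane) :
    localTriangle Δ x =
      (convexHull ℝ (Δ : Set Plane)).indicator (fun y => Metric.infDist y Δ ^ 2) x -
        volume.real (hiddenRadiiSq Δ x) := by
  by_cases hx : x ∈ convexHull ℝ (Δ : Set Plane)
  · rw [localTriangle_of_mem_hull hx, Set.indicator_of_mem hx, hiddenRadiiSq_of_mem_hull hx,
      measureReal_empty, sub_zero]
  · have hle : Metric.infDist x Δ ≤ Metric.infDist x (visibleVertices Δ x) :=
      Metric.infDist_le_infDist_of_subset (fun _ hv => hv.1) (hT.visibleVertices_nonempty hx)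
    rw [Set.indicator_of_notMem hx, hT.hiddenRadiiSq_of_notMem_hull hx, Real.volume_real_Ico_of_le
      (pow_le_pow_left₀ Metric.infDist_nonneg hle 2), localTriangle]
    ring

end HiddenRadii

section LocalInequality

variable {S T T' : Finset Plane} {K : Geometry.SimplicialComplex ℝ Plane} {x : Plane}

theorem localVoronoi_eq {F : Finset (Finset Plane)} (hF : ∀ T ∈ F, IsTriangle T) (x : Plane) :
    localVoronoi F x =
      ∑ T ∈ F, (convexHull ℝ (T : Set Plane)).indicator (fun y => Metric.infDist y T ^ 2) x -
        ∑ T ∈ F, volume.real (hiddenRadiiSq T x) := by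
  rw [localVoronoi, ← Finset.sum_sub_distrib]
  exact Finset.sum_congr rfl fun T hT => (hF T hT).localTriangle_eq x

theorem volume_hiddenRadiiSq_biUnion_ne_top {F : Finset (Finset Plane)}
    (hF : ∀ T ∈ F, IsTriangle T) (x : Plane) : volume (⋃ T ∈ F, hiddenRadiiSq T x) ≠ ⊤ :=
  measure_biUnion_ne_top F.finite_toSet fun T hT => (hF T hT).volume_hiddenRadiiSq_ne_top x

theorem isTriangle_of_mem_delaunay (hT : T ∈ delaunay S) : IsTriangle T :=
  (mem_delaunay_iff.1 hT).2.1

theorem GeneralPosition.volume_hiddenRadiiSq_biUnion_delaunay (hS : GeneralPosition S)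
    (x : Plane) : volume.real (⋃ T ∈ delaunay S, hiddenRadiiSq T x) =
      ∑ T ∈ delaunay S, volume.real (hiddenRadiiSq T x) := by
  refine measureReal_biUnion_finset (fun T hT T' hT' hne => Set.disjoint_left.2 fun t ht ht' => ?_)
    (fun T hT => (isTriangle_of_mem_delaunay hT).measurableSet_hiddenRadiiSq x)
    (fun T hT => (isTriangle_of_mem_delaunay hT).volume_hiddenRadiiSq_ne_top x)
  exact hne (ht.2.eq_of_mem_delaunay ht'.2 hS hT hT')

theorem IsGeometricTriangulation.localVoronoi_le_of_notMem_hull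
    (hK : IsGeometricTriangulation S K) (hS : GeneralPosition S)
    (hi : (interior (convexHull ℝ (S : Set Plane))).Nonempty)
    (hx : x ∉ convexHull ℝ (S : Set Plane)) :
    localVoronoi (triangles S K) x ≤ localVoronoi (delaunay S) x := by
  have hzero {F : Finset (Finset Plane)} (hF : ∀ T ∈ F, T ⊆ S) :
      ∑ T ∈ F, (convexHull ℝ (T : Set Plane)).indicator (fun y => Metric.infDist y T ^ 2) x = 0 :=
    Finset.sum_eq_zero fun T hT =>
      Set.indicator_of_notMem (fun hxT => hx (convexHull_mono (hF T hT) hxT)) _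
  have hsub : (⋃ T ∈ delaunay S, hiddenRadiiSq T x) ⊆ ⋃ T ∈ triangles S K, hiddenRadiiSq T x :=
    Set.iUnion₂_subset fun T hT t ht => by
      obtain ⟨T', hT', h'⟩ := hK.exists_hidesVertex_of_delaunay hi hx hT ht.2
      exact Set.mem_biUnion hT' ⟨ht.1, h'⟩
  have htri : ∀ T ∈ triangles S K, IsTriangle T := fun _ => isTriangle_of_mem_triangles
  have hle := (measureReal_mono hsub (volume_hiddenRadiiSq_biUnion_ne_top htri x)).trans
    (measureReal_biUnion_finset_le _ _)
  rw [hS.volume_hiddenRadiiSq_biUnion_delaunay] at hle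
  rw [localVoronoi_eq htri, localVoronoi_eq fun _ => isTriangle_of_mem_delaunay,
    hzero fun T hT => (mem_triangles.1 hT).1.1, hzero fun T hT => (mem_delaunay_iff.1 hT).1]
  linarith

theorem IsGeometricTriangulation.localVoronoi_le_sq_infDist (hK : IsGeometricTriangulation S K)
    (hi : (interior (convexHull ℝ (S : Set Plane))).Nonempty)
    (hx : x ∈ convexHull ℝ (S : Set Plane))
    (huniq : ∀ T ∈ triangles S K, ∀ T' ∈ triangles S K, T ≠ T' →
      x ∈ convexHull ℝ (T : Set Plane) → x ∉ convexHull ℝ (T' : Set Plane)) :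
    localVoronoi (triangles S K) x ≤ Metric.infDist x (S : Set Plane) ^ 2 := by
  have htri : ∀ T ∈ triangles S K, IsTriangle T := fun _ => isTriangle_of_mem_triangles
  obtain ⟨T₀, hT₀, hxT₀⟩ := Set.mem_iUnion₂.1 (hK.hull_subset hi hx)
  have hne : (T₀ : Set Plane).Nonempty := (htri T₀ hT₀).nonempty
  have hT₀S : (T₀ : Set Plane) ⊆ S := (mem_triangles.1 hT₀).1.1
  have hsum : ∑ T ∈ triangles S K,
      (convexHull ℝ (T : Set Plane)).indicator (fun y => Metric.infDist y T ^ 2) x =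
        Metric.infDist x T₀ ^ 2 := by
    rw [Finset.sum_eq_single_of_mem T₀ hT₀ fun T hT hne =>
      Set.indicator_of_notMem (huniq T₀ hT₀ T hT hne.symm hxT₀) _, Set.indicator_of_mem hxT₀]
  have hsub : Set.Ico (Metric.infDist x (S : Set Plane) ^ 2) (Metric.infDist x T₀ ^ 2) ⊆
      ⋃ T ∈ triangles S K, hiddenRadiiSq T x := fun t ht => by
    have ht0 : 0 ≤ t := (sq_nonneg _).trans ht.1
    obtain ⟨s, hs, hsx⟩ := (infDist_le_iff_of_finite S.finite_toSet (hne.mono hT₀S)).1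
      ((Real.le_sqrt Metric.infDist_nonneg ht0).2 ht.1)
    have hfar := (lt_infDist_iff_of_finite T₀.finite_toSet hne).1
      ((Real.sqrt_lt ht0 Metric.infDist_nonneg).2 ht.2)
    obtain ⟨T, hT, h⟩ := hK.exists_hidesVertex_of_far hi hT₀ hfar hxT₀ huniq hs hsx
    exact Set.mem_biUnion hT ⟨ht0, h⟩
  have hle := (measureReal_mono hsub (volume_hiddenRadiiSq_biUnion_ne_top htri x)).trans
    (measureReal_biUnion_finset_le _ _)
  rw [Real.volume_real_Ico_of_le (pow_le_pow_left₀ Metric.infDist_nonneg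
    (Metric.infDist_le_infDist_of_subset hT₀S hne) 2)] at hle
  rw [localVoronoi_eq htri, hsum]
  linarith

theorem GeneralPosition.sq_infDist_le_localVoronoi (hS : GeneralPosition S)
    (hi : (interior (convexHull ℝ (S : Set Plane))).Nonempty)
    (hx : x ∈ convexHull ℝ (S : Set Plane)) :
    Metric.infDist x (S : Set Plane) ^ 2 ≤ localVoronoi (delaunay S) x := by
  obtain ⟨T₀, hT₀, hxT₀⟩ := Set.mem_iUnion₂.1 (hull_subset_delaunay hi hx)
  have hne : (T₀ : Set Plane).Nonempty := (isTriangle_of_mem_delaunay hT₀).nonempty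
  have hT₀S : (T₀ : Set Plane) ⊆ S := (mem_delaunay_iff.1 hT₀).1
  have hsum : Metric.infDist x T₀ ^ 2 ≤ ∑ T ∈ delaunay S,
      (convexHull ℝ (T : Set Plane)).indicator (fun y => Metric.infDist y T ^ 2) x := by
    rw [← Set.indicator_of_mem hxT₀ fun y => Metric.infDist y T₀ ^ 2]
    exact Finset.single_le_sum (f := fun T : Finset Plane =>
      (convexHull ℝ (T : Set Plane)).indicator (fun y => Metric.infDist y T ^ 2) x)
      (fun T _ => Set.indicator_nonneg (fun _ _ => sq_nonneg _) x) hT₀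
  have hsub : (⋃ T ∈ delaunay S, hiddenRadiiSq T x) ⊆
      Set.Ico (Metric.infDist x (S : Set Plane) ^ 2) (Metric.infDist x T₀ ^ 2) := by
    refine Set.iUnion₂_subset fun T hT t ⟨ht, h⟩ => ⟨?_, ?_⟩
    · obtain ⟨B, hB, hB2⟩ := h
      exact (Real.le_sqrt Metric.infDist_nonneg ht).1 ((infDist_le_iff_of_finite S.finite_toSet
        (hne.mono hT₀S)).2 ⟨B 2, (mem_delaunay_iff.1 hT).1 (basis_mem hB 2), hB2.dist_le⟩)
    · exact (Real.sqrt_lt ht Metric.infDist_nonneg).1 ((lt_infDist_iff_of_finite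
        T₀.finite_toSet hne).2 fun w hw => h.lt_dist_of_mem_hull hS hT hT₀ hxT₀ hw)
  have hle := measureReal_mono (μ := volume) hsub measure_Ico_lt_top.ne
  rw [Real.volume_real_Ico_of_le (pow_le_pow_left₀ Metric.infDist_nonneg
    (Metric.infDist_le_infDist_of_subset hT₀S hne) 2),
    hS.volume_hiddenRadiiSq_biUnion_delaunay] at hle
  rw [localVoronoi_eq fun _ => isTriangle_of_mem_delaunay]
  linarith

theorem IsGeometricTriangulation.localVoronoi_nonpos_of_mem (hK : IsGeometricTriangulation S K)
    (hx : x ∈ S) : localVoronoi (triangles S K) x ≤ 0 := by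
  have htri : ∀ T ∈ triangles S K, IsTriangle T := fun _ => isTriangle_of_mem_triangles
  rw [localVoronoi_eq htri, Finset.sum_eq_zero fun T hT => ?_, zero_sub, neg_nonpos]
  · exact Finset.sum_nonneg fun T _ => measureReal_nonneg
  · refine Set.indicator_apply_eq_zero.2 fun hxT => ?_
    rw [Metric.infDist_zero_of_mem (hK.mem_of_mem_hull hT hx hxT), zero_pow two_ne_zero]

theorem IsTriangle.interior_hull_nonempty (hT : IsTriangle T) (hTS : T ⊆ S) :
    (interior (convexHull ℝ (S : Set Plane))).Nonempty := by
  obtain ⟨B, hB, -⟩ := hT.exists_basis hT.nonempty.choose_spec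
  refine (interior_convexHull_nonempty_iff_affineSpan_eq_top.2 B.tot).mono (interior_mono ?_)
  exact convexHull_mono (hB ▸ hTS)

theorem localVoronoi_le (hS : GeneralPosition S) (hK : IsGeometricTriangulation S K)
    (hx : ∀ T ∈ triangles S K, ∀ T' ∈ triangles S K, T ≠ T' →
      x ∈ convexHull ℝ (T : Set Plane) → x ∈ convexHull ℝ (T' : Set Plane) → x ∈ S) :
    localVoronoi (triangles S K) x ≤ localVoronoi (delaunay S) x := by
  by_cases hi : (interior (convexHull ℝ (S : Set Plane))).Nonempty
  · by_cases hxS : x ∈ convexHull ℝ (S : Set Plane)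
    · refine le_trans ?_ (hS.sq_infDist_le_localVoronoi hi hxS)
      by_cases hxm : x ∈ S
      · exact (hK.localVoronoi_nonpos_of_mem hxm).trans (sq_nonneg _)
      · exact hK.localVoronoi_le_sq_infDist hi hxS fun T hT T' hT' hne h h' =>
          hxm (hx T hT T' hT' hne h h')
    · exact hK.localVoronoi_le_of_notMem_hull hS hi hxS
  · have hempty {F : Finset (Finset Plane)} (hF : ∀ T ∈ F, T ⊆ S ∧ IsTriangle T) : F = ∅ :=
      Finset.eq_empty_of_forall_notMem fun T hT =>
        hi ((hF T hT).2.interior_hull_nonempty (hF T hT).1)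
    rw [hempty fun T hT => ⟨(mem_triangles.1 hT).1.1, isTriangle_of_mem_triangles hT⟩,
      hempty fun T hT => ⟨(mem_delaunay_iff.1 hT).1, isTriangle_of_mem_delaunay hT⟩]

end LocalInequality

/-! ### Second moments of simplices -/

section Haar

variable {ι E F : Type*} [NormedAddCommGroup E] [NormedSpace ℝ E] [FiniteDimensional ℝ E]
  [MeasurableSpace E] [BorelSpace E] {μ : Measure E} [μ.IsAddHaarMeasure]
  [NormedAddCommGroup F] [NormedSpace ℝ F]

theorem addHaar_affineMap_eq_zero {f : E →ᵃ[ℝ] ℝ} {y : E} (hy : f y ≠ 0) :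
    μ {x | f x = 0} = 0 := by
  let H : AffineSubspace ℝ E := (AffineSubspace.mk' (0 : ℝ) ⊥).comap f
  have hmem (x : E) : x ∈ H ↔ f x = 0 := by
    simp [H, AffineSubspace.mem_comap, AffineSubspace.mem_mk']
  have hH : (H : Set E) = {x | f x = 0} := Set.ext hmem
  rw [← hH]
  exact Measure.addHaar_affineSubspace μ H fun htop =>
    hy ((hmem y).1 (htop ▸ AffineSubspace.mem_top ℝ E y))

theorem addHaar_image_affineMap (f : E →ᵃ[ℝ] E) (s : Set E) :
    μ (f '' s) = ENNReal.ofReal |LinearMap.det f.linear| * μ s := by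
  have hf : f '' s = (f 0 + ·) '' (f.linear '' s) := by
    rw [Set.image_image]
    exact Set.image_congr fun x _ => by rw [congrFun f.decomp x, Pi.add_apply, add_comm]
  rw [hf, Set.image_add_left, measure_preimage_add, Measure.addHaar_image_linearMap]

theorem setIntegral_image_affineMap {f : E →ᵃ[ℝ] E} (hf : LinearMap.det f.linear ≠ 0)
    {s : Set E} (hs : MeasurableSet s) (g : E → F) :
    ∫ x in f '' s, g x ∂μ = |LinearMap.det f.linear| • ∫ x in s, g (f x) ∂μ := by
  have hderiv (x : E) : HasFDerivAt f f.linear.toContinuousLinearMap x := by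
    rw [f.decomp]
    exact f.linear.toContinuousLinearMap.hasFDerivAt.add_const (f 0)
  have hinj : Function.Injective f :=
    f.linear_injective_iff.1 (LinearMap.equivOfDetNeZero f.linear hf).injective
  rw [integral_image_eq_integral_abs_det_fderiv_smul μ hs
    (fun x _ => (hderiv x).hasFDerivWithinAt) hinj.injOn, ← integral_smul]
  rfl

variable {B : AffineBasis ι ℝ E} {i j : ι} {s x : E}

theorem measureReal_convexHull_range_update [DecidableEq ι] :
    μ.real (convexHull ℝ (Set.range (Function.update B i s))) =
      |B.coord i s| * μ.real (convexHull ℝ (Set.range B)) := by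
  rw [range_update_eq, ← AffineMap.image_convexHull, Measure.real, addHaar_image_affineMap,
    det_linear_moveVertex, ENNReal.toReal_mul, ENNReal.toReal_ofReal (abs_nonneg _), Measure.real]

end Haar

section Bisection

variable {ι E : Type*} [AddCommGroup E] [Module ℝ E] {B : AffineBasis ι ℝ E} {i j : ι}

theorem coord_midpoint_left (hij : i ≠ j) : B.coord i (midpoint ℝ (B i) (B j)) = 1 / 2 := by
  rw [AffineMap.map_midpoint, B.coord_apply_eq, B.coord_apply_ne hij, midpoint_eq_smul_add]
  norm_num

theorem coord_midpoint_right (hij : i ≠ j) : B.coord j (midpoint ℝ (B i) (B j)) = 1 / 2 := by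
  rw [midpoint_comm, coord_midpoint_left hij.symm]

theorem image_moveVertex_midpoint [Finite ι] (hij : i ≠ j) :
    moveVertex B i (midpoint ℝ (B i) (B j)) '' convexHull ℝ (Set.range B) =
      {x ∈ convexHull ℝ (Set.range B) | B.coord i x ≤ B.coord j x} := by
  classical
  ext x
  rw [AffineMap.image_convexHull, ← range_update_eq, mem_convexHull_range_update_iff
    (by rw [coord_midpoint_left hij]; norm_num), coord_midpoint_left hij, Set.mem_sep_iff,
    mem_convexHull_range_iff]
  constructor
  · rintro ⟨hi, h⟩
    have hle := h j hij.symm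
    rw [coord_midpoint_right hij] at hle
    refine ⟨fun k => ?_, by linarith⟩
    rcases eq_or_ne k i with rfl | hki
    · linarith
    rcases eq_or_ne k j with rfl | hkj
    · linarith
    have := h k hki
    rwa [AffineMap.map_midpoint, B.coord_apply_ne hki, B.coord_apply_ne hkj, midpoint_self,
      mul_zero] at this
  · rintro ⟨h, hle⟩
    refine ⟨by linarith [h i], fun k hki => ?_⟩
    rcases eq_or_ne k j with rfl | hkj
    · rw [coord_midpoint_right hij]
      linarith
    · rw [AffineMap.map_midpoint, B.coord_apply_ne hki, B.coord_apply_ne hkj, midpoint_self,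
        mul_zero]
      exact h k

end Bisection

section Moments

variable {ι E : Type*} [NormedAddCommGroup E] [NormedSpace ℝ E]
  {B : AffineBasis ι ℝ E} {i j : ι}

theorem isCompact_convexHull_range [Finite ι] : IsCompact (convexHull ℝ (Set.range B)) :=
  (Set.finite_range B).isCompact_convexHull ℝ

theorem continuous_coord [Finite ι] : Continuous (B.coord i) :=
  have := B.finiteDimensional
  (B.coord i).continuous_of_finiteDimensional

variable [MeasurableSpace E] [BorelSpace E] {μ : Measure E} [μ.IsAddHaarMeasure] {g : E → ℝ}

theorem integrableOn_convexHull_range [Finite ι] (hg : Continuous g) :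
    IntegrableOn g (convexHull ℝ (Set.range B)) μ :=
  hg.continuousOn.integrableOn_compact isCompact_convexHull_range

theorem setIntegral_coord_le [Finite ι] (hij : i ≠ j) :
    ∫ x in {x ∈ convexHull ℝ (Set.range B) | B.coord i x ≤ B.coord j x}, g x ∂μ =
      (∫ x in convexHull ℝ (Set.range B),
        g (moveVertex B i (midpoint ℝ (B i) (B j)) x) ∂μ) / 2 := by
  have := B.finiteDimensional
  have hdet : LinearMap.det (moveVertex B i (midpoint ℝ (B i) (B j))).linear = 1 / 2 := by
    rw [det_linear_moveVertex, coord_midpoint_left hij]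
  rw [← image_moveVertex_midpoint hij, setIntegral_image_affineMap (by rw [hdet]; norm_num)
    isCompact_convexHull_range.measurableSet, hdet, abs_of_pos one_half_pos, smul_eq_mul,
    one_div_mul_eq_div]

theorem setIntegral_eq_add_coord_le [Finite ι] (hij : i ≠ j) (hg : Continuous g) :
    ∫ x in convexHull ℝ (Set.range B), g x ∂μ =
      ∫ x in {x ∈ convexHull ℝ (Set.range B) | B.coord i x ≤ B.coord j x}, g x ∂μ +
        ∫ x in {x ∈ convexHull ℝ (Set.range B) | B.coord j x ≤ B.coord i x}, g x ∂μ := by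
  have := B.finiteDimensional
  have hclosed : IsClosed {x | B.coord i x ≤ B.coord j x} :=
    isClosed_le continuous_coord continuous_coord
  have hint : IntegrableOn g (convexHull ℝ (Set.range B)) μ := integrableOn_convexHull_range hg
  rw [← integral_inter_add_sdiff hclosed.measurableSet hint]
  congr 1
  refine setIntegral_congr_set ?_
  have hnull : μ {x | (B.coord i - B.coord j) x = 0} = 0 :=
    addHaar_affineMap_eq_zero (y := B i) (by simp [B.coord_apply_ne hij.symm])
  filter_upwards [measure_eq_zero_iff_ae_notMem.1 hnull] with x hx
  have hne : B.coord i x ≠ B.coord j x := fun h => hx (sub_eq_zero.2 h)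
  exact propext (and_congr_right fun _ => (not_le.trans (hne.symm.le_iff_lt).symm))

variable (μ) in
theorem integral_eq_bisection [Finite ι] (B : AffineBasis ι ℝ E) (hij : i ≠ j)
    (hg : Continuous g) :
    ∫ x in convexHull ℝ (Set.range B), g x ∂μ =
      (∫ x in convexHull ℝ (Set.range B),
          g (moveVertex B i (midpoint ℝ (B i) (B j)) x) ∂μ +
        ∫ x in convexHull ℝ (Set.range B),
          g (moveVertex B j (midpoint ℝ (B i) (B j)) x) ∂μ) / 2 := by
  rw [setIntegral_eq_add_coord_le hij hg, setIntegral_coord_le hij, setIntegral_coord_le hij.symm,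
    midpoint_comm, ← add_div]

-- The median through the midpoint of the edge `ij` cuts the simplex into two affine images of
-- itself, which makes the second moments satisfy linear relations that determine them up to
-- scaling.
variable (μ) in
theorem three_mul_integral_coord_sq [Finite ι] (B : AffineBasis ι ℝ E) (hij : i ≠ j) :
    3 * ∫ x in convexHull ℝ (Set.range B), B.coord i x * B.coord i x ∂μ =
      4 * (∫ x in convexHull ℝ (Set.range B), B.coord i x * B.coord j x ∂μ) +
        ∫ x in convexHull ℝ (Set.range B), B.coord j x * B.coord j x ∂μ := by
  have hcont (k : ι) : Continuous (B.coord k) := continuous_coord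
  have hint (k l : ι) : IntegrableOn (fun x => B.coord k x * B.coord l x)
      (convexHull ℝ (Set.range B)) μ :=
    integrableOn_convexHull_range ((hcont k).mul (hcont l))
  have h := integral_eq_bisection μ B hij (g := fun x => B.coord i x * B.coord i x)
    ((hcont i).mul (hcont i))
  have hi (x : E) : B.coord i (moveVertex B i (midpoint ℝ (B i) (B j)) x) =
      B.coord i x / 2 := by
    rw [moveVertex_apply, coord_add_smul_sub, coord_midpoint_left hij, B.coord_apply_eq]
    ring
  have hj (x : E) : B.coord i (moveVertex B j (midpoint ℝ (B i) (B j)) x) =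
      B.coord i x + B.coord j x / 2 := by
    rw [moveVertex_apply, coord_add_smul_sub, coord_midpoint_left hij, B.coord_apply_ne hij]
    ring
  have hi' : ∫ x in convexHull ℝ (Set.range B), B.coord i x / 2 * (B.coord i x / 2) ∂μ =
      (∫ x in convexHull ℝ (Set.range B), B.coord i x * B.coord i x ∂μ) / 4 := by
    rw [← integral_div]
    congr with x
    ring
  have hj' : ∫ x in convexHull ℝ (Set.range B),
      (B.coord i x + B.coord j x / 2) * (B.coord i x + B.coord j x / 2) ∂μ =
      (∫ x in convexHull ℝ (Set.range B), B.coord i x * B.coord i x ∂μ) +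
        (∫ x in convexHull ℝ (Set.range B), B.coord i x * B.coord j x ∂μ) +
        (∫ x in convexHull ℝ (Set.range B), B.coord j x * B.coord j x ∂μ) / 4 := by
    rw [← integral_div, ← integral_add (hint i i) (hint i j), ← integral_add
      (f := fun x => B.coord i x * B.coord i x + B.coord i x * B.coord j x)
      ((hint i i).add (hint i j)) ((hint j j).div_const 4)]
    congr with x
    ring
  simp only [hi, hj, hi', hj'] at h
  linarith

variable (μ) in
theorem integral_coord_mul_coord [Fintype ι] [DecidableEq ι] (B : AffineBasis ι ℝ E) (i j : ι) :
    ∫ x in convexHull ℝ (Set.range B), B.coord i x * B.coord j x ∂μ =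
      (if i = j then 2 else 1) * (μ.real (convexHull ℝ (Set.range B)) /
        (Fintype.card ι * (Fintype.card ι + 1))) := by
  set m : ι → ι → ℝ := fun i j =>
    ∫ x in convexHull ℝ (Set.range B), B.coord i x * B.coord j x ∂μ
  have hcomm (k l : ι) : m k l = m l k := by simp only [m, mul_comm]
  have hdiag (k : ι) : m k k = m i i := by
    rcases eq_or_ne k i with rfl | hk
    · rfl
    · linarith [three_mul_integral_coord_sq μ B hk, three_mul_integral_coord_sq μ B hk.symm,
        hcomm i k]
  have hm (k l : ι) : m k l = m i i / 2 + if k = l then m i i / 2 else 0 := by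
    split_ifs with hkl
    · rw [← hkl, hdiag, add_halves]
    · linarith [three_mul_integral_coord_sq μ B hkl, hdiag k, hdiag l]
  have hsum : ∑ k, ∑ l, m k l = μ.real (convexHull ℝ (Set.range B)) := by
    have hint (k l : ι) : IntegrableOn (fun x => B.coord k x * B.coord l x)
        (convexHull ℝ (Set.range B)) μ :=
      integrableOn_convexHull_range (continuous_coord.mul continuous_coord)
    simp only [m]
    simp_rw [← integral_finsetSum _ fun l _ => hint _ l]
    rw [← integral_finsetSum _ fun k _ => integrable_finsetSum _ fun l _ => hint k l]
    simp_rw [← Finset.mul_sum, B.sum_coord_apply_eq_one, mul_one, B.sum_coord_apply_eq_one]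
    rw [setIntegral_const, smul_eq_mul, mul_one]
  have hcard : (Fintype.card ι : ℝ) * (Fintype.card ι + 1) ≠ 0 := by
    have : Nonempty ι := ⟨i⟩
    positivity
  have hval : μ.real (convexHull ℝ (Set.range B)) / (Fintype.card ι * (Fintype.card ι + 1)) =
      m i i / 2 := by
    rw [div_eq_iff hcard, ← hsum, eq_comm]
    calc m i i / 2 * (Fintype.card ι * (Fintype.card ι + 1))
        = ∑ k : ι, ∑ l : ι, (m i i / 2 + if k = l then m i i / 2 else 0) := by
          simp only [Finset.sum_add_distrib, Finset.sum_const, Finset.card_univ, nsmul_eq_mul,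
            Finset.sum_ite_eq, Finset.mem_univ, if_true]
          ring
      _ = ∑ k, ∑ l, m k l :=
          Finset.sum_congr rfl fun k _ => Finset.sum_congr rfl fun l _ => (hm k l).symm
  rw [hval]
  refine (hm i j).trans ?_
  split_ifs <;> ring

variable {V : Type*} [NormedAddCommGroup V] [InnerProductSpace ℝ V]

variable (μ) in
theorem integral_norm_sq_sum_coord_smul [Fintype ι] (B : AffineBasis ι ℝ E) (v : ι → V) :
    ∫ x in convexHull ℝ (Set.range B), ‖∑ i, B.coord i x • v i‖ ^ 2 ∂μ =
      μ.real (convexHull ℝ (Set.range B)) / (Fintype.card ι * (Fintype.card ι + 1)) *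
        (‖∑ i, v i‖ ^ 2 + ∑ i, ‖v i‖ ^ 2) := by
  classical
  have hint (k l : ι) : IntegrableOn (fun x => B.coord k x * B.coord l x * inner ℝ (v k) (v l))
      (convexHull ℝ (Set.range B)) μ :=
    integrableOn_convexHull_range ((continuous_coord.mul continuous_coord).mul continuous_const)
  have hexpand (x : E) : ‖∑ i, B.coord i x • v i‖ ^ 2 =
      ∑ k, ∑ l, B.coord k x * B.coord l x * inner ℝ (v k) (v l) := by
    rw [← real_inner_self_eq_norm_sq, sum_inner]
    simp only [inner_sum, real_inner_smul_left, real_inner_smul_right]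
    exact Finset.sum_congr rfl fun k _ => Finset.sum_congr rfl fun l _ => by ring
  simp_rw [hexpand]
  rw [integral_finsetSum _ fun k _ => integrable_finsetSum _ fun l _ => hint k l]
  simp_rw [integral_finsetSum _ fun l _ => hint _ l, integral_mul_const,
    integral_coord_mul_coord μ B]
  have hsplit (k l : ι) : (if k = l then (2 : ℝ) else 1) = 1 + if k = l then 1 else 0 := by
    split_ifs <;> norm_num
  simp only [hsplit, add_mul, ite_mul, one_mul, zero_mul, Finset.sum_add_distrib,
    Finset.sum_ite_eq, Finset.mem_univ, if_true, real_inner_self_eq_norm_sq, ← Finset.mul_sum]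
  rw [← mul_add, ← real_inner_self_eq_norm_sq (∑ i, v i), sum_inner]
  simp only [inner_sum]

end Moments

section Kite

theorem sq_dist_sub_sq_dist_eq_sum {ι E V : Type*} [Fintype ι] [AddCommGroup E] [Module ℝ E]
    [NormedAddCommGroup V] [InnerProductSpace ℝ V] (B : AffineBasis ι ℝ E) (f : E →ᵃ[ℝ] V)
    (p q : V) (x : E) : dist (f x) p ^ 2 - dist (f x) q ^ 2 =
      ∑ i, B.coord i x * (dist (f (B i)) p ^ 2 - dist (f (B i)) q ^ 2) := by
  simpa [powerDiff_apply, EuclideanGeometry.Sphere.power] using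
    affineMap_apply_eq_sum_coord B ((powerDiff ⟨p, 0⟩ ⟨q, 0⟩).comp f) x

variable {E V : Type*} [NormedAddCommGroup E] [NormedSpace ℝ E] [NormedAddCommGroup V]
  [InnerProductSpace ℝ V] {B : AffineBasis (Fin 3) ℝ E} {i j k : Fin 3}

theorem sum_fin_three_of_ne {M : Type*} [AddCommMonoid M] (hij : i ≠ j) (hik : i ≠ k)
    (hjk : j ≠ k) (f : Fin 3 → M) : ∑ l, f l = f i + f j + f k := by
  have huniv : (Finset.univ : Finset (Fin 3)) = {i, j, k} := by
    revert i j k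
    decide
  rw [huniv, Finset.sum_insert (by simp [hij, hik]), Finset.sum_pair hjk, add_assoc]

theorem sq_dist_sub_sq_dist_of_dist_eq (f : E →ᵃ[ℝ] V) (hij : i ≠ j) (hik : i ≠ k) (hjk : j ≠ k)
    (hf : dist (f (B i)) (f (B k)) = dist (f (B j)) (f (B k))) (x : E) :
    dist (f x) (f (B i)) ^ 2 - dist (f x) (f (B j)) ^ 2 =
      (B.coord j x - B.coord i x) * dist (f (B i)) (f (B j)) ^ 2 := by
  rw [sq_dist_sub_sq_dist_eq_sum B, sum_fin_three_of_ne hij hik hjk, dist_self, dist_self,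
    dist_comm (f (B k)), dist_comm (f (B k)), dist_comm (f (B j)) (f (B i)), hf]
  ring

variable [MeasurableSpace E] [BorelSpace E] {μ : Measure E} [μ.IsAddHaarMeasure]

theorem setIntegral_sq_dist_moveVertex_midpoint (f : E →ᵃ[ℝ] V) (hij : i ≠ j) (hik : i ≠ k)
    (hjk : j ≠ k) (hf : dist (f (B i)) (f (B k)) = dist (f (B j)) (f (B k))) :
    ∫ x in convexHull ℝ (Set.range B),
        dist (f (moveVertex B i (midpoint ℝ (B i) (B j)) x)) (f (B j)) ^ 2 ∂μ =
      μ.real (convexHull ℝ (Set.range B)) / 12 *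
        (dist (f (B i)) (f (B j)) ^ 2 + 2 * dist (f (B i)) (f (B k)) ^ 2) := by
  let g : E →ᵃ[ℝ] V :=
    f.comp (moveVertex B i (midpoint ℝ (B i) (B j))) - AffineMap.const ℝ E (f (B j))
  have hg (x : E) : g x = f (moveVertex B i (midpoint ℝ (B i) (B j)) x) - f (B j) := rfl
  set u : V := f (B i) - f (B j)
  set w : V := f (B k) - f (B j)
  have hgi : g (B i) = (2⁻¹ : ℝ) • u := by
    rw [hg, moveVertex_apply, B.coord_apply_eq, one_smul, add_sub_cancel, AffineMap.map_midpoint,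
      midpoint_sub_right, invOf_eq_inv]
  have hgj : g (B j) = 0 := by
    rw [hg, moveVertex_apply, B.coord_apply_ne hij, zero_smul, add_zero, sub_self]
  have hgk : g (B k) = w := by
    rw [hg, moveVertex_apply, B.coord_apply_ne hik, zero_smul, add_zero]
  have hw : dist (f (B i)) (f (B k)) = ‖w‖ := by rw [hf, dist_comm, dist_eq_norm]
  have hinner : 2 * inner ℝ u w = ‖u‖ ^ 2 := by
    have huw : ‖u - w‖ = ‖w‖ := by rw [sub_sub_sub_cancel_right, ← dist_eq_norm, hw]
    have := norm_sub_sq_real u w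
    rw [huw] at this
    linarith
  have hnorm (x : E) : dist (f (moveVertex B i (midpoint ℝ (B i) (B j)) x)) (f (B j)) =
      ‖∑ l, B.coord l x • g (B l)‖ := by
    rw [← affineMap_apply_eq_sum_coord_smul, hg, dist_eq_norm]
  simp_rw [hnorm]
  rw [integral_norm_sq_sum_coord_smul, sum_fin_three_of_ne hij hik hjk,
    sum_fin_three_of_ne hij hik hjk, hgi, hgj, hgk, hw, dist_eq_norm _ (f (B j)), add_zero,
    norm_add_sq_real, norm_smul, real_inner_smul_left, norm_zero,
    Real.norm_of_nonneg (by norm_num), Fintype.card_fin]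
  push_cast
  linear_combination (μ.real (convexHull ℝ (Set.range B)) / 24) * hinner

theorem setIntegral_min_sq_dist (f : E →ᵃ[ℝ] V) (hij : i ≠ j) (hik : i ≠ k) (hjk : j ≠ k)
    (hf : dist (f (B i)) (f (B k)) = dist (f (B j)) (f (B k))) :
    ∫ x in convexHull ℝ (Set.range B),
        min (dist (f x) (f (B i)) ^ 2) (dist (f x) (f (B j)) ^ 2) ∂μ =
      μ.real (convexHull ℝ (Set.range B)) / 12 *
        (dist (f (B i)) (f (B j)) ^ 2 + 2 * dist (f (B i)) (f (B k)) ^ 2) := by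
  have := B.finiteDimensional
  have hcont : Continuous f := f.continuous_of_finiteDimensional
  have hmeas (i j : Fin 3) :
      MeasurableSet {x ∈ convexHull ℝ (Set.range B) | B.coord i x ≤ B.coord j x} :=
    isCompact_convexHull_range.measurableSet.inter
      (isClosed_le continuous_coord continuous_coord).measurableSet
  have hdiff := sq_dist_sub_sq_dist_of_dist_eq (B := B) f hij hik hjk hf
  have hnear_j {x : E} (hx : B.coord i x ≤ B.coord j x) :
      min (dist (f x) (f (B i)) ^ 2) (dist (f x) (f (B j)) ^ 2) = dist (f x) (f (B j)) ^ 2 :=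
    min_eq_right (sub_nonneg.1 (hdiff x ▸ mul_nonneg (sub_nonneg.2 hx) (sq_nonneg _)))
  have hnear_i {x : E} (hx : B.coord j x ≤ B.coord i x) :
      min (dist (f x) (f (B i)) ^ 2) (dist (f x) (f (B j)) ^ 2) = dist (f x) (f (B i)) ^ 2 :=
    min_eq_left (sub_nonpos.1 (hdiff x ▸ mul_nonpos_of_nonpos_of_nonneg (sub_nonpos.2 hx)
      (sq_nonneg _)))
  rw [setIntegral_eq_add_coord_le hij (by fun_prop),
    setIntegral_congr_fun (hmeas i j) fun x hx => hnear_j hx.2,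
    setIntegral_congr_fun (hmeas j i) fun x hx => hnear_i hx.2,
    setIntegral_coord_le hij, setIntegral_coord_le hij.symm,
    setIntegral_sq_dist_moveVertex_midpoint f hij hik hjk hf,
    setIntegral_sq_dist_moveVertex_midpoint f hij.symm hjk hik hf.symm, hf,
    dist_comm (f (B j)) (f (B i)), add_halves]

theorem setIntegral_update_min_sq_dist {B : AffineBasis (Fin 3) ℝ V} [MeasurableSpace V]
    [BorelSpace V] {μ : Measure V} [μ.IsAddHaarMeasure] {o : V} (hij : i ≠ j) (hik : i ≠ k)
    (hjk : j ≠ k) (ho : dist (B i) o = dist (B j) o) :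
    ∫ x in convexHull ℝ (Set.range (Function.update B k o)),
        min (dist x (B i) ^ 2) (dist x (B j) ^ 2) ∂μ =
      |B.coord k o| * μ.real (convexHull ℝ (Set.range B)) / 12 *
        (dist (B i) (B j) ^ 2 + 2 * dist (B i) o ^ 2) := by
  have := B.finiteDimensional
  rcases eq_or_ne (B.coord k o) 0 with hk | hk
  · have hcompact : IsCompact (convexHull ℝ (Set.range (Function.update B k o))) :=
      (Set.finite_range _).isCompact_convexHull ℝ
    have hzero := measureReal_convexHull_range_update (μ := μ) (B := B) (i := k) (s := o)
    rw [hk, abs_zero, zero_mul, measureReal_eq_zero_iff hcompact.measure_ne_top] at hzero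
    rw [setIntegral_measure_zero _ hzero, hk, abs_zero, zero_mul, zero_div, zero_mul]
  · have hM (l : Fin 3) (hl : l ≠ k) : moveVertex B k o (B l) = B l := by
      rw [moveVertex_apply, B.coord_apply_ne hl.symm, zero_smul, add_zero]
    have hMk : moveVertex B k o (B k) = o := by
      rw [moveVertex_apply, B.coord_apply_eq, one_smul, add_sub_cancel]
    have hkite := setIntegral_min_sq_dist (μ := μ) (moveVertex B k o) hij hik hjk
      (by rwa [hM i hik, hM j hjk, hMk])
    rw [hM i hik, hM j hjk, hMk] at hkite
    rw [range_update_eq, ← AffineMap.image_convexHull, setIntegral_image_affineMap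
      (by rwa [det_linear_moveVertex]) isCompact_convexHull_range.measurableSet, hkite,
      det_linear_moveVertex, smul_eq_mul, ← mul_assoc, mul_div_assoc]

end Kite

/-! ### Non-acute triangles -/

section Obtuse

variable {V : Type*} [NormedAddCommGroup V] [InnerProductSpace ℝ V]
  {B : AffineBasis (Fin 3) ℝ V} {i j k : Fin 3} {o : V}

theorem sq_dist_sub_sq_dist_eq (hij : i ≠ j) (hik : i ≠ k) (hjk : j ≠ k) (x : V) :
    dist x (B i) ^ 2 - dist x (B k) ^ 2 =
      (1 - 2 * B.coord i x) * dist (B i) (B k) ^ 2 -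
        2 * B.coord j x * inner ℝ (B i - B k) (B j - B k) := by
  have hsum := B.sum_coord_apply_eq_one x
  have hcos := norm_sub_sq_real (B i - B k) (B j - B k)
  rw [sum_fin_three_of_ne hij hik hjk] at hsum
  rw [sub_sub_sub_cancel_right, ← dist_eq_norm, ← dist_eq_norm, ← dist_eq_norm] at hcos
  have h := sq_dist_sub_sq_dist_eq_sum B (AffineMap.id ℝ V) (B i) (B k) x
  simp only [AffineMap.id_apply, sum_fin_three_of_ne hij hik hjk, dist_self, dist_comm (B k) (B i),
    dist_comm (B j) (B i)] at h
  linear_combination h + B.coord j x * hcos + dist (B i) (B k) ^ 2 * hsum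

/-- `o` is the circumcenter of a triangle whose angle at the vertex `B 2` is not acute. -/
structure IsObtuseCircumcenter (B : AffineBasis (Fin 3) ℝ V) (o : V) : Prop where
  dist_eq : ∀ i, dist o (B i) = dist o (B 2)
  inner_nonpos : inner ℝ (B 0 - B 2) (B 1 - B 2) ≤ 0

namespace IsObtuseCircumcenter

theorem inner_nonpos_of_ne (h : IsObtuseCircumcenter B o) (hij : i ≠ j) (hi : i ≠ 2) (hj : j ≠ 2) :
    inner ℝ (B i - B 2) (B j - B 2) ≤ 0 := by
  have h01 := h.inner_nonpos
  have h10 := real_inner_comm (B 0 - B 2) (B 1 - B 2) ▸ h01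
  fin_cases i <;> fin_cases j <;> first | contradiction | assumption

theorem mul_sq_dist_eq (h : IsObtuseCircumcenter B o) (hij : i ≠ j) (hi : i ≠ 2) (hj : j ≠ 2) :
    (1 - 2 * B.coord i o) * dist (B i) (B 2) ^ 2 =
      2 * B.coord j o * inner ℝ (B i - B 2) (B j - B 2) := by
  rw [← sub_eq_zero, ← sq_dist_sub_sq_dist_eq hij hi hj, h.dist_eq i, sub_self]

theorem half_le_coord (h : IsObtuseCircumcenter B o) (hij : i ≠ j) (hi : i ≠ 2) (hj : j ≠ 2) :
    1 / 2 ≤ B.coord i o := by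
  have hdist {k : Fin 3} (hk : k ≠ 2) : 0 < dist (B k) (B 2) ^ 2 :=
    pow_pos (dist_pos.2 (B.ind.injective.ne hk)) 2
  have hG := h.inner_nonpos_of_ne hij hi hj
  have hEi := h.mul_sq_dist_eq hij hi hj
  have hEj := h.mul_sq_dist_eq hij.symm hj hi
  rw [real_inner_comm] at hEj
  have hcs := real_inner_mul_inner_self_le (B i - B 2) (B j - B 2)
  rw [real_inner_self_eq_norm_sq, real_inner_self_eq_norm_sq, ← dist_eq_norm, ← dist_eq_norm]
    at hcs
  set G : ℝ := inner ℝ (B i - B 2) (B j - B 2)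
  set P : ℝ := dist (B i) (B 2) ^ 2
  set Q : ℝ := dist (B j) (B 2) ^ 2
  by_contra! hlt
  have hj_neg : B.coord j o < 0 := by
    by_contra! hj0
    have := mul_pos (show 0 < 1 - 2 * B.coord i o by linarith) (hdist hi)
    linarith [mul_nonpos_of_nonneg_of_nonpos hj0 hG]
  have hi_neg : B.coord i o < 0 := by
    by_contra! hi0
    have := mul_pos (show 0 < 1 - 2 * B.coord j o by linarith) (hdist hj)
    linarith [mul_nonpos_of_nonneg_of_nonpos hi0 hG]
  have hprod : (1 - 2 * B.coord i o) * (1 - 2 * B.coord j o) * (P * Q) =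
      4 * (B.coord i o * B.coord j o) * (G * G) := by
    linear_combination (1 - 2 * B.coord j o) * Q * hEi + 2 * B.coord j o * G * hEj
  have hpos : 0 < (1 - 2 * B.coord i o - 2 * B.coord j o) * (P * Q) :=
    mul_pos (by linarith) (mul_pos (hdist hi) (hdist hj))
  linarith [hprod, mul_le_mul_of_nonneg_left hcs (mul_pos_of_neg_of_neg hi_neg hj_neg).le]

theorem coord_pos (h : IsObtuseCircumcenter B o) (hi : i ≠ 2) : 0 < B.coord i o := by
  obtain ⟨j, hij, hj⟩ : ∃ j, i ≠ j ∧ j ≠ 2 := by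
    revert i
    decide
  linarith [h.half_le_coord hij hi hj]

theorem coord_two_nonpos (h : IsObtuseCircumcenter B o) : B.coord 2 o ≤ 0 := by
  have hsum := B.sum_coord_apply_eq_one o
  rw [Fin.sum_univ_three] at hsum
  linarith [h.half_le_coord (i := 0) (j := 1) (by decide) (by decide) (by decide),
    h.half_le_coord (i := 1) (j := 0) (by decide) (by decide) (by decide)]

theorem coord_mul_sq_dist_sub (h : IsObtuseCircumcenter B o) (hij : i ≠ j) (hi : i ≠ 2)
    (hj : j ≠ 2) (x : V) :
    B.coord j o * (dist x (B i) ^ 2 - dist x (B 2) ^ 2) =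
      ((B.coord j x * B.coord i o - B.coord i x * B.coord j o) +
        (B.coord 2 x * B.coord j o - B.coord j x * B.coord 2 o)) * dist (B i) (B 2) ^ 2 := by
  have hx := B.sum_coord_apply_eq_one x
  have ho := B.sum_coord_apply_eq_one o
  rw [sum_fin_three_of_ne hij hi hj] at hx ho
  rw [sq_dist_sub_sq_dist_eq hij hi hj]
  linear_combination B.coord j x * h.mul_sq_dist_eq hij hi hj +
    dist (B i) (B 2) ^ 2 * (B.coord j x * ho - B.coord j o * hx)

theorem sum_coord_mul_sq_dist (h : IsObtuseCircumcenter B o) (j : Fin 3) :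
    ∑ i, B.coord i o * dist (B i) (B j) ^ 2 = 2 * dist o (B 2) ^ 2 := by
  have hsum := sq_dist_sub_sq_dist_eq_sum B (AffineMap.id ℝ V) (B j) o o
  simp only [AffineMap.id_apply, h.dist_eq j, dist_self, mul_sub, Finset.sum_sub_distrib,
    dist_comm _ o, h.dist_eq, ← Finset.sum_mul, B.sum_coord_apply_eq_one] at hsum
  linarith

end IsObtuseCircumcenter

end Obtuse

section Hidden

variable {Δ : Finset Plane} {B : AffineBasis (Fin 3) ℝ Plane} {i j : Fin 3} {x : Plane} {ρ : ℝ}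

theorem Hides.inner_neg (h : Hides B x ρ) (hij : i ≠ j) (hi : i ≠ 2) (hj : j ≠ 2) :
    inner ℝ (B i - B 2) (B j - B 2) < 0 := by
  have hsum := B.sum_coord_apply_eq_one x
  rw [sum_fin_three_of_ne hij hi hj] at hsum
  have hcoord {k l : Fin 3} (hkl : k ≠ l) (hk : k ≠ 2) (hl : l ≠ 2)
      (hG : 0 ≤ inner ℝ (B k - B 2) (B l - B 2)) : B.coord k x < 1 / 2 := by
    have hlt : dist x (B 2) ^ 2 < dist x (B k) ^ 2 := by
      rw [dist_comm, dist_comm x]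
      exact pow_lt_pow_left₀ (h.dist_le.trans_lt (h.lt_dist k hk)) dist_nonneg two_ne_zero
    have hdiff := sq_dist_sub_sq_dist_eq (B := B) hkl hk hl x
    have hpos : 0 < (1 - 2 * B.coord k x) * dist (B k) (B 2) ^ 2 := by
      linarith [mul_nonneg (h.coord_nonneg l hl) hG]
    linarith [pos_of_mul_pos_left hpos (sq_nonneg _)]
  by_contra! hG
  linarith [hcoord hij hi hj hG, hcoord hij.symm hj hi (real_inner_comm (B i - B 2) _ ▸ hG),
    h.coord_neg]

theorem Hides.inner_neg_of_mem (h : Hides B x ρ) (hΔ : (Δ : Set Plane) = Set.range B)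
    {p q : Plane} (hp : p ∈ Δ) (hq : q ∈ Δ) (hpq : p ≠ q) (hp2 : p ≠ B 2) (hq2 : q ≠ B 2) :
    inner ℝ (p - B 2) (q - B 2) < 0 := by
  obtain ⟨i, rfl⟩ := (mem_iff_exists_eq hΔ).1 hp
  obtain ⟨j, rfl⟩ := (mem_iff_exists_eq hΔ).1 hq
  exact h.inner_neg (ne_of_apply_ne B hpq) (ne_of_apply_ne B hp2) (ne_of_apply_ne B hq2)

theorem angle_lt_pi_div_two_iff {V : Type*} [NormedAddCommGroup V] [InnerProductSpace ℝ V]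
    {p q r : V} (hp : p ≠ q) (hr : r ≠ q) :
    EuclideanGeometry.angle p q r < Real.pi / 2 ↔ 0 < inner ℝ (p - q) (r - q) := by
  have hpos : 0 < ‖p - q‖ * ‖r - q‖ :=
    mul_pos (norm_pos_iff.2 (sub_ne_zero.2 hp)) (norm_pos_iff.2 (sub_ne_zero.2 hr))
  rw [EuclideanGeometry.angle, InnerProductGeometry.angle, Real.arccos_lt_pi_div_two,
    vsub_eq_sub, vsub_eq_sub, div_pos_iff_of_pos_right hpos]

theorem IsAcute.not_hidesVertex (hΔ : IsAcute Δ) : ¬ HidesVertex Δ x ρ := by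
  rintro ⟨B, hB, h⟩
  have hne {i : Fin 3} (hi : i ≠ 2) : B i ≠ B 2 := B.ind.injective.ne hi
  have h01 : B 0 ≠ B 1 := B.ind.injective.ne (by decide)
  have h02 := hne (i := 0) (by decide)
  have h12 := hne (i := 1) (by decide)
  have hangle := hΔ _ (basis_mem hB 0) _ (basis_mem hB 2) _ (basis_mem hB 1) h02 h12.symm h01
  rw [angle_lt_pi_div_two_iff h02 h12] at hangle
  exact hangle.not_gt (h.inner_neg (by decide) (by decide) (by decide))

theorem IsTriangle.localTriangle_eq_zero (hT : IsTriangle Δ)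
    (hx : x ∉ convexHull ℝ (Δ : Set Plane)) (h : ∀ ρ, ¬ HidesVertex Δ x ρ) :
    localTriangle Δ x = 0 := by
  have hle := h (Metric.infDist x Δ)
  rw [hidesVertex_iff hT hx, and_iff_right le_rfl, not_lt] at hle
  have hge : Metric.infDist x Δ ≤ Metric.infDist x (visibleVertices Δ x) :=
    Metric.infDist_le_infDist_of_subset (fun _ hv => hv.1) (hT.visibleVertices_nonempty hx)
  rw [localTriangle, hge.antisymm hle, sub_self]

theorem HidesVertex.hides_of_inner_nonpos (h : HidesVertex Δ x ρ) (hT : IsTriangle Δ)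
    (hΔ : (Δ : Set Plane) = Set.range B)
    (hG : ∀ i j, i ≠ j → i ≠ 2 → j ≠ 2 → inner ℝ (B i - B 2) (B j - B 2) ≤ 0) : Hides B x ρ := by
  obtain ⟨B', hΔ', h'⟩ := id h
  have hx := h'.notMem_hull hΔ'
  suffices hB : B' 2 = B 2 from
    hides_of_dist_le hΔ hx (hB ▸ h'.dist_le) ((lt_infDist_iff_of_finite (finite_visibleVertices Δ x)
      (hT.visibleVertices_nonempty hx)).1 ((hidesVertex_iff hT hx).1 h).2)
  obtain ⟨i, hi⟩ := (mem_iff_exists_eq hΔ).1 (basis_mem hΔ' 2)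
  rw [← hi]
  by_contra! hne
  have hi2 : i ≠ 2 := ne_of_apply_ne B hne
  obtain ⟨j, hij, hj2⟩ : ∃ j, i ≠ j ∧ j ≠ 2 := by
    clear hi hne
    revert i
    decide
  have hneg := h'.inner_neg_of_mem hΔ' (basis_mem hΔ 2) (basis_mem hΔ j)
    (B.ind.injective.ne hj2.symm) (hi ▸ hne.symm) (hi ▸ B.ind.injective.ne hij.symm)
  rw [← hi, ← sub_sub_sub_cancel_right (B j) (B i) (B 2), inner_sub_right, ← neg_sub (B i),
    inner_neg_left, inner_neg_left, real_inner_self_eq_norm_sq] at hneg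
  linarith [hG i j hij hi2 hj2, sq_nonneg ‖B i - B 2‖]

end Hidden

section Decomposition

variable {Δ : Finset Plane} {B : AffineBasis (Fin 3) ℝ Plane} {i j k : Fin 3} {o x : Plane} {ρ : ℝ}

theorem sq_infDist_eq_min {s : Set Plane} {p q : Plane} (hp : p ∈ s) (hq : q ∈ s)
    (h : ∀ v ∈ s, min (dist x p ^ 2) (dist x q ^ 2) ≤ dist x v ^ 2) :
    Metric.infDist x s ^ 2 = min (dist x p ^ 2) (dist x q ^ 2) := by
  have hmin : min (dist x p ^ 2) (dist x q ^ 2) = min (dist x p) (dist x q) ^ 2 :=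
    (pow_left_monotoneOn.map_min dist_nonneg dist_nonneg).symm
  rw [hmin] at h ⊢
  congr 1
  refine le_antisymm (le_min (Metric.infDist_le_dist_of_mem hp) (Metric.infDist_le_dist_of_mem hq))
    ((Metric.le_infDist ⟨p, hp⟩).2 fun v hv => ?_)
  exact le_of_sq_le_sq (h v hv) dist_nonneg

/-- The triangle obtained from the one with vertices `B 0`, `B 1`, `B 2` by moving the vertex `B k`
to `o`, which may be degenerate. -/
def movedTriangle (B : AffineBasis (Fin 3) ℝ Plane) (k : Fin 3) (o : Plane) : Set Plane :=
  convexHull ℝ (Set.range (Function.update B k o))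

namespace IsObtuseCircumcenter

theorem mem_movedTriangle_iff (h : IsObtuseCircumcenter B o) (hk : k ≠ 2) :
    x ∈ movedTriangle B k o ↔
      0 ≤ B.coord k x ∧ ∀ l ≠ k, B.coord k x * B.coord l o ≤ B.coord l x * B.coord k o := by
  have hpos := h.coord_pos hk
  simp only [movedTriangle, mem_convexHull_range_update_iff hpos.ne', le_div_iff₀ hpos, zero_mul,
    div_mul_eq_mul_div, div_le_iff₀ hpos]

theorem mem_movedTriangle_two_iff (h : IsObtuseCircumcenter B o) (hx : B.coord 2 x ≠ 0) :
    x ∈ movedTriangle B 2 o ↔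
      B.coord 2 x < 0 ∧ ∀ k ≠ 2, B.coord k x * B.coord 2 o ≤ B.coord 2 x * B.coord k o := by
  rcases h.coord_two_nonpos.lt_or_eq with hneg | hzero
  · simp only [movedTriangle, mem_convexHull_range_update_iff hneg.ne, le_div_iff_of_neg hneg,
      zero_mul, div_mul_eq_mul_div, div_le_iff_of_neg hneg, hx.le_iff_lt]
  · have hsub : movedTriangle B 2 o ⊆ B.coord 2 ⁻¹' {0} := by
      refine convexHull_min ?_ ((convex_singleton 0).affine_preimage _)
      rintro _ ⟨k, rfl⟩
      rcases eq_or_ne k 2 with rfl | hk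
      · simpa using hzero
      · simp [hk, hk.symm]
    refine iff_of_false (fun hmem => hx (hsub hmem)) fun ⟨hc, hle⟩ => ?_
    have := hle 0 (by decide)
    rw [hzero, mul_zero] at this
    exact this.not_gt (mul_neg_of_neg_of_pos hc (h.coord_pos (by decide)))

theorem not_hidesVertex (h : IsObtuseCircumcenter B o) (hT : IsTriangle Δ)
    (hΔ : (Δ : Set Plane) = Set.range B) (hij : i ≠ j) (hi : i ≠ 2) (hj : j ≠ 2)
    (hlt : B.coord j x * B.coord i o < B.coord i x * B.coord j o)
    (hle : 0 ≤ B.coord j x → B.coord 2 x * B.coord j o ≤ B.coord j x * B.coord 2 o) :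
    ¬ HidesVertex Δ x ρ := by
  intro hv
  have hx := hv.hides_of_inner_nonpos hT hΔ fun _ _ => h.inner_nonpos_of_ne
  have hdist : dist x (B 2) ^ 2 < dist x (B i) ^ 2 := by
    rw [dist_comm, dist_comm x]
    exact pow_lt_pow_left₀ (hx.dist_le.trans_lt (hx.lt_dist i hi)) dist_nonneg two_ne_zero
  have hpos := mul_pos (h.coord_pos hj) (sub_pos.2 hdist)
  rw [h.coord_mul_sq_dist_sub hij hi hj] at hpos
  linarith [pos_of_mul_pos_left hpos (sq_nonneg _), hle (hx.coord_nonneg j hj)]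

theorem sq_infDist_eq (h : IsObtuseCircumcenter B o) (hΔ : (Δ : Set Plane) = Set.range B)
    (hij : i ≠ j) (hi : i ≠ 2) (hj : j ≠ 2)
    (hlt : B.coord j x * B.coord i o < B.coord i x * B.coord j o)
    (hle : B.coord i x * B.coord 2 o ≤ B.coord 2 x * B.coord i o) :
    Metric.infDist x Δ ^ 2 = min (dist x (B i) ^ 2) (dist x (B 2) ^ 2) := by
  have hdist : 0 ≤ B.coord i o * (dist x (B j) ^ 2 - dist x (B 2) ^ 2) := by
    rw [h.coord_mul_sq_dist_sub hij.symm hj hi]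
    exact mul_nonneg (by linarith) (sq_nonneg _)
  have hj_le := sub_nonneg.1 (nonneg_of_mul_nonneg_right hdist (h.coord_pos hi))
  refine sq_infDist_eq_min (basis_mem hΔ i) (basis_mem hΔ 2) fun v hv => ?_
  obtain ⟨k, rfl⟩ := (mem_iff_exists_eq hΔ).1 hv
  obtain rfl | rfl | rfl : k = i ∨ k = j ∨ k = 2 := by omega
  exacts [min_le_left _ _, min_le_of_right_le hj_le, min_le_right _ _]

theorem notMem_movedTriangle (h : IsObtuseCircumcenter B o) (hij : i ≠ j) (hi : i ≠ 2)
    (hlt : B.coord j x * B.coord i o < B.coord i x * B.coord j o) : x ∉ movedTriangle B i o := by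
  rw [h.mem_movedTriangle_iff hi]
  exact fun hmem => (hmem.2 j hij.symm).not_gt hlt

theorem mem_movedTriangle_iff_of_lt (h : IsObtuseCircumcenter B o)
    (hij : i ≠ j) (hi : i ≠ 2) (hj : j ≠ 2)
    (hlt : B.coord j x * B.coord i o < B.coord i x * B.coord j o) :
    x ∈ movedTriangle B j o ↔
      0 ≤ B.coord j x ∧ B.coord j x * B.coord 2 o ≤ B.coord 2 x * B.coord j o := by
  rw [h.mem_movedTriangle_iff hj]
  refine and_congr_right fun _ => ⟨fun hle => hle 2 hj.symm, fun hle l hl => ?_⟩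
  obtain rfl | rfl : l = i ∨ l = 2 := by omega
  exacts [hlt.le, hle]

theorem localTriangle_eq_of_coord_pos (h : IsObtuseCircumcenter B o) (hT : IsTriangle Δ)
    (hΔ : (Δ : Set Plane) = Set.range B) (hij : i ≠ j) (hi : i ≠ 2) (hj : j ≠ 2)
    (hx : 0 < B.coord 2 x) (hlt : B.coord j x * B.coord i o < B.coord i x * B.coord j o) :
    localTriangle Δ x = (movedTriangle B j o).indicator
      (fun y => min (dist y (B i) ^ 2) (dist y (B 2) ^ 2)) x := by
  have hγ := h.coord_two_nonpos
  have hcoord {l : Fin 3} (hl : l ≠ 2) (hlx : 0 ≤ B.coord l x) :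
      B.coord l x * B.coord 2 o ≤ B.coord 2 x * B.coord l o :=
    (mul_nonpos_of_nonneg_of_nonpos hlx hγ).trans (mul_pos hx (h.coord_pos hl)).le
  have hmem : x ∈ movedTriangle B j o ↔ 0 ≤ B.coord j x := by
    rw [h.mem_movedTriangle_iff_of_lt hij hi hj hlt]
    exact and_iff_left_of_imp (hcoord hj)
  by_cases hjx : 0 ≤ B.coord j x
  · have hix : 0 < B.coord i x := pos_of_mul_pos_left
      ((mul_nonneg hjx (h.coord_pos hi).le).trans_lt hlt) (h.coord_pos hj).le
    have hhull : x ∈ convexHull ℝ (Δ : Set Plane) := by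
      rw [mem_hull_iff hΔ]
      intro l
      obtain rfl | rfl | rfl : l = i ∨ l = j ∨ l = 2 := by omega
      exacts [hix.le, hjx, hx.le]
    rw [Set.indicator_of_mem (hmem.2 hjx), localTriangle_of_mem_hull hhull,
      h.sq_infDist_eq hΔ hij hi hj hlt (hcoord hi hix.le)]
  · rw [Set.indicator_of_notMem (mt hmem.1 hjx)]
    exact hT.localTriangle_eq_zero (fun hhull => hjx ((mem_hull_iff hΔ).1 hhull j))
      fun _ hv => hx.not_gt
        (hv.hides_of_inner_nonpos hT hΔ fun _ _ => h.inner_nonpos_of_ne).coord_neg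

theorem mem_movedTriangle_two_iff_of_lt (h : IsObtuseCircumcenter B o)
    (hij : i ≠ j) (hi : i ≠ 2) (hj : j ≠ 2) (hx : B.coord 2 x < 0)
    (hlt : B.coord j x * B.coord i o < B.coord i x * B.coord j o) :
    x ∈ movedTriangle B 2 o ↔ x ∈ movedTriangle B j o := by
  rw [h.mem_movedTriangle_two_iff hx.ne, h.mem_movedTriangle_iff_of_lt hij hi hj hlt,
    and_iff_right hx]
  constructor
  · intro hle
    have hprod := (hle j hj).trans_lt (mul_neg_of_neg_of_pos hx (h.coord_pos hj))
    exact ⟨(pos_of_mul_neg_left hprod h.coord_two_nonpos).le, hle j hj⟩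
  · rintro ⟨-, hle⟩ l hl
    obtain rfl | rfl : l = i ∨ l = j := by omega
    · refine le_of_mul_le_mul_right ?_ (h.coord_pos hj)
      linarith [mul_le_mul_of_nonpos_right hlt.le h.coord_two_nonpos,
        mul_le_mul_of_nonneg_right hle (h.coord_pos hi).le]
    · exact hle

theorem sq_infDist_visibleVertices_eq (hΔ : (Δ : Set Plane) = Set.range B)
    (hij : i ≠ j) (hi : i ≠ 2) (hj : j ≠ 2) (hix : 0 < B.coord i x) (hjx : 0 < B.coord j x)
    (hx : B.coord 2 x < 0) : Metric.infDist x (visibleVertices Δ x) ^ 2 =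
      min (dist x (B i) ^ 2) (dist x (B j) ^ 2) := by
  have hvis {l : Fin 3} (hl : l ≠ 2) : B l ∈ visibleVertices Δ x :=
    (mem_visibleVertices_iff hΔ).2 (Or.inr ⟨2, hl.symm, hx⟩)
  refine sq_infDist_eq_min (hvis hi) (hvis hj) fun v hv => ?_
  obtain ⟨l, rfl⟩ := (mem_iff_exists_eq hΔ).1 hv.1
  obtain rfl | rfl | rfl : l = i ∨ l = j ∨ l = 2 := by omega
  · exact min_le_left _ _
  · exact min_le_right _ _
  · rcases (mem_visibleVertices_iff hΔ).1 hv with rfl | ⟨m, hm, hmx⟩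
    · norm_num at hx
    · obtain rfl | rfl : m = i ∨ m = j := by omega
      exacts [(hmx.not_gt hix).elim, (hmx.not_gt hjx).elim]

theorem localTriangle_eq_of_coord_neg (h : IsObtuseCircumcenter B o) (hT : IsTriangle Δ)
    (hΔ : (Δ : Set Plane) = Set.range B) (hij : i ≠ j) (hi : i ≠ 2) (hj : j ≠ 2)
    (hx : B.coord 2 x < 0) (hlt : B.coord j x * B.coord i o < B.coord i x * B.coord j o) :
    localTriangle Δ x = (movedTriangle B j o).indicator
      (fun y => min (dist y (B i) ^ 2) (dist y (B 2) ^ 2) -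
        min (dist y (B i) ^ 2) (dist y (B j) ^ 2)) x := by
  have hmem := h.mem_movedTriangle_iff_of_lt hij hi hj hlt
  by_cases hxj : x ∈ movedTriangle B j o
  · have hle := (h.mem_movedTriangle_two_iff hx.ne).1
      ((h.mem_movedTriangle_two_iff_of_lt hij hi hj hx hlt).2 hxj)
    have hpos {l : Fin 3} (hl : l ≠ 2) : 0 < B.coord l x := pos_of_mul_neg_left
      ((hle.2 l hl).trans_lt (mul_neg_of_neg_of_pos hx (h.coord_pos hl))) h.coord_two_nonpos
    rw [Set.indicator_of_mem hxj, localTriangle, h.sq_infDist_eq hΔ hij hi hj hlt (hle.2 i hi),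
      sq_infDist_visibleVertices_eq hΔ hij hi hj (hpos hi) (hpos hj) hx]
  · rw [Set.indicator_of_notMem hxj]
    refine hT.localTriangle_eq_zero (fun hhull => hx.not_ge ((mem_hull_iff hΔ).1 hhull 2))
      fun _ => h.not_hidesVertex hT hΔ hij hi hj hlt fun hjx => ?_
    rw [hmem, not_and, not_le] at hxj
    exact (hxj hjx).le

theorem localTriangle_eq_of_lt (h : IsObtuseCircumcenter B o) (hT : IsTriangle Δ)
    (hΔ : (Δ : Set Plane) = Set.range B) (hij : i ≠ j) (hi : i ≠ 2) (hj : j ≠ 2)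
    (hx : B.coord 2 x ≠ 0) (hlt : B.coord j x * B.coord i o < B.coord i x * B.coord j o) :
    localTriangle Δ x =
      (movedTriangle B i o).indicator (fun y => min (dist y (B j) ^ 2) (dist y (B 2) ^ 2)) x +
      (movedTriangle B j o).indicator (fun y => min (dist y (B i) ^ 2) (dist y (B 2) ^ 2)) x -
      (movedTriangle B 2 o).indicator (fun y => min (dist y (B i) ^ 2) (dist y (B j) ^ 2)) x := by
  rw [Set.indicator_of_notMem (h.notMem_movedTriangle hij hi hlt), zero_add]
  rcases hx.lt_or_gt with hneg | hpos
  · rw [h.localTriangle_eq_of_coord_neg hT hΔ hij hi hj hneg hlt]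
    have hiff := h.mem_movedTriangle_two_iff_of_lt hij hi hj hneg hlt
    by_cases hxj : x ∈ movedTriangle B j o
    · rw [Set.indicator_of_mem hxj, Set.indicator_of_mem hxj, Set.indicator_of_mem (hiff.2 hxj)]
    · rw [Set.indicator_of_notMem hxj, Set.indicator_of_notMem hxj,
        Set.indicator_of_notMem (mt hiff.1 hxj), sub_zero]
  · have hmem : x ∉ movedTriangle B 2 o := fun hmem =>
      ((h.mem_movedTriangle_two_iff hx).1 hmem).1.not_gt hpos
    rw [h.localTriangle_eq_of_coord_pos hT hΔ hij hi hj hpos hlt, Set.indicator_of_notMem hmem,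
      sub_zero]

theorem localTriangle_ae_eq (h : IsObtuseCircumcenter B o) (hT : IsTriangle Δ)
    (hΔ : (Δ : Set Plane) = Set.range B) :
    localTriangle Δ =ᵐ[volume]
      (movedTriangle B 0 o).indicator (fun y => min (dist y (B 1) ^ 2) (dist y (B 2) ^ 2)) +
      (movedTriangle B 1 o).indicator (fun y => min (dist y (B 0) ^ 2) (dist y (B 2) ^ 2)) -
      (movedTriangle B 2 o).indicator (fun y => min (dist y (B 0) ^ 2) (dist y (B 1) ^ 2)) := by
  have hcoord := addHaar_affineMap_eq_zero (μ := volume) (f := B.coord 2) (y := B 2) (by simp)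
  have hdiag := addHaar_affineMap_eq_zero (μ := volume)
    (f := B.coord 1 o • B.coord 0 - B.coord 0 o • B.coord 1) (y := B 0)
    (by simpa using (h.coord_pos (i := 1) (by decide)).ne')
  filter_upwards [measure_eq_zero_iff_ae_notMem.1 hcoord, measure_eq_zero_iff_ae_notMem.1 hdiag]
    with x hx hne
  have hne' : B.coord 1 x * B.coord 0 o ≠ B.coord 0 x * B.coord 1 o := by
    contrapose! hne
    simp [mul_comm (B.coord 1 o), mul_comm (B.coord 0 o), hne]
  rcases hne'.lt_or_gt with hlt | hlt
  · exact h.localTriangle_eq_of_lt hT hΔ (by decide) (by decide) (by decide) hx hlt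
  · rw [h.localTriangle_eq_of_lt hT hΔ (by decide) (by decide) (by decide) hx hlt]
    simp only [Pi.add_apply, Pi.sub_apply, min_comm (dist _ (B 1) ^ 2) (dist _ (B 0) ^ 2)]
    rw [add_comm (Set.indicator (movedTriangle B 1 o) _ x)]

end IsObtuseCircumcenter

end Decomposition

/-! ### Integration of the local functional -/

section Integral

variable {Δ : Finset Plane} {B : AffineBasis (Fin 3) ℝ Plane} {k : Fin 3} {o : Plane} {r : ℝ}

theorem sum_eq_sum_basis {M : Type*} [AddCommMonoid M] (hΔ : (Δ : Set Plane) = Set.range B)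
    (f : Plane → M) : ∑ v ∈ Δ, f v = ∑ i, f (B i) := by
  refine (Finset.sum_nbij B (fun i _ => basis_mem hΔ i) B.ind.injective.injOn (fun v hv => ?_)
    fun _ _ => rfl).symm
  obtain ⟨i, hi⟩ := (mem_iff_exists_eq hΔ).1 hv
  exact ⟨i, Finset.mem_coe.2 (Finset.mem_univ i), hi⟩

theorem sumSqEdges_eq (hΔ : (Δ : Set Plane) = Set.range B) :
    sumSqEdges Δ = dist (B 0) (B 2) ^ 2 + dist (B 1) (B 2) ^ 2 + dist (B 0) (B 1) ^ 2 := by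
  simp only [sumSqEdges, sum_eq_sum_basis hΔ, Fin.sum_univ_three, dist_self, dist_comm (B 2),
    dist_comm (B 1) (B 0)]
  ring

theorem circumradius_eq (hΔ : (Δ : Set Plane) = Set.range B) (ho : ∀ i, dist (B i) o = r) :
    circumradius Δ = r := by
  have hspan (c : Plane) : c ∈ affineSpan ℝ (Set.range B) := B.tot ▸ AffineSubspace.mem_top ℝ _ c
  have hset : {r : ℝ | ∃ c : Plane, ∀ v ∈ Δ, dist v c = r} = {r} := by
    refine Set.eq_singleton_iff_unique_mem.2 ⟨⟨o, fun v hv => ?_⟩, fun r' ⟨c, hc⟩ => ?_⟩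
    · obtain ⟨i, rfl⟩ := (mem_iff_exists_eq hΔ).1 hv
      exact ho i
    · have hsphere := B.ind.existsUnique_dist_eq.unique
        (y₁ := (⟨c, r'⟩ : EuclideanGeometry.Sphere Plane)) (y₂ := ⟨o, r⟩)
        ⟨hspan c, Set.range_subset_iff.2 fun i => hc _ (basis_mem hΔ i)⟩
        ⟨hspan o, Set.range_subset_iff.2 ho⟩
      exact congrArg EuclideanGeometry.Sphere.radius hsphere
  rw [circumradius, hset, csInf_singleton]

theorem isCompact_movedTriangle : IsCompact (movedTriangle B k o) :=
  (Set.finite_range _).isCompact_convexHull ℝ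

theorem integrable_indicator_movedTriangle (p q : Plane) :
    Integrable ((movedTriangle B k o).indicator
      fun y => min (dist y p ^ 2) (dist y q ^ 2)) := by
  have hcont : Continuous fun y => min (dist y p ^ 2) (dist y q ^ 2) := by fun_prop
  exact (integrable_indicator_iff isCompact_movedTriangle.measurableSet).2
    (hcont.continuousOn.integrableOn_compact isCompact_movedTriangle)

namespace IsObtuseCircumcenter

theorem integral_indicator_movedTriangle {i j : Fin 3} (h : IsObtuseCircumcenter B o)
    (hΔ : (Δ : Set Plane) = Set.range B) (hij : i ≠ j) (hik : i ≠ k) (hjk : j ≠ k) :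
    ∫ y, (movedTriangle B k o).indicator
        (fun y => min (dist y (B i) ^ 2) (dist y (B j) ^ 2)) y =
      |B.coord k o| * area Δ / 12 * (dist (B i) (B j) ^ 2 + 2 * circumradius Δ ^ 2) := by
  have hR := circumradius_eq hΔ fun l => (dist_comm _ _).trans (h.dist_eq l)
  have ho (l : Fin 3) : dist (B l) o = circumradius Δ := by rw [hR, dist_comm, h.dist_eq]
  rw [integral_indicator isCompact_movedTriangle.measurableSet, movedTriangle,
    setIntegral_update_min_sq_dist hij hik hjk (by rw [ho, ho]), ho, area, hΔ]

theorem integrable_localTriangle (h : IsObtuseCircumcenter B o) (hT : IsTriangle Δ)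
    (hΔ : (Δ : Set Plane) = Set.range B) : Integrable (localTriangle Δ) :=
  (((integrable_indicator_movedTriangle _ _).add (integrable_indicator_movedTriangle _ _)).sub
    (integrable_indicator_movedTriangle _ _)).congr (h.localTriangle_ae_eq hT hΔ).symm

theorem integral_localTriangle (h : IsObtuseCircumcenter B o) (hT : IsTriangle Δ)
    (hΔ : (Δ : Set Plane) = Set.range B) :
    ∫ x, localTriangle Δ x = area Δ / 12 * (sumSqEdges Δ - 4 * circumradius Δ ^ 2) := by
  have hR : circumradius Δ = dist o (B 2) :=
    circumradius_eq hΔ fun l => (dist_comm _ _).trans (h.dist_eq l)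
  have hsum := B.sum_coord_apply_eq_one o
  have h0 := h.sum_coord_mul_sq_dist 0
  have h1 := h.sum_coord_mul_sq_dist 1
  have h2 := h.sum_coord_mul_sq_dist 2
  simp only [Fin.sum_univ_three, dist_self, dist_comm (B 2), dist_comm (B 1) (B 0), ← hR]
    at hsum h0 h1 h2
  rw [integral_congr_ae (h.localTriangle_ae_eq hT hΔ), integral_sub'
    ((integrable_indicator_movedTriangle _ _).add (integrable_indicator_movedTriangle _ _))
    (integrable_indicator_movedTriangle _ _), integral_add'
    (integrable_indicator_movedTriangle _ _) (integrable_indicator_movedTriangle _ _),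
    h.integral_indicator_movedTriangle hΔ (by decide) (by decide) (by decide),
    h.integral_indicator_movedTriangle hΔ (by decide) (by decide) (by decide),
    h.integral_indicator_movedTriangle hΔ (by decide) (by decide) (by decide),
    abs_of_pos (h.coord_pos (by decide)), abs_of_pos (h.coord_pos (by decide)),
    abs_of_nonpos h.coord_two_nonpos, sumSqEdges_eq hΔ]
  linear_combination area Δ / 12 * ((2 * circumradius Δ ^ 2 + dist (B 0) (B 2) ^ 2 +
    dist (B 1) (B 2) ^ 2 + dist (B 0) (B 1) ^ 2) * hsum - h0 - h1 - h2)

end IsObtuseCircumcenter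

theorem IsTriangle.exists_isObtuseCircumcenter (hT : IsTriangle Δ) (hΔ : ¬ IsAcute Δ) :
    ∃ B : AffineBasis (Fin 3) ℝ Plane, (Δ : Set Plane) = Set.range B ∧
      ∃ o, IsObtuseCircumcenter B o := by
  unfold IsAcute at hΔ
  push Not at hΔ
  obtain ⟨p, hp, r, hr, q, hq, hpr, hrq, hpq, hangle⟩ := hΔ
  rw [← not_lt, angle_lt_pi_div_two_iff hpr hrq.symm, not_lt] at hangle
  obtain ⟨B, hB, rfl⟩ := hT.exists_basis hr
  obtain ⟨s, hs⟩ := hT.exists_sphere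
  refine ⟨B, hB, s.center, fun i => ?_, ?_⟩
  · rw [dist_comm, hs _ (basis_mem hB i), dist_comm, hs _ (basis_mem hB 2)]
  · obtain ⟨i, rfl⟩ := (mem_iff_exists_eq hB).1 hp
    obtain ⟨j, rfl⟩ := (mem_iff_exists_eq hB).1 hq
    have hi : i ≠ 2 := ne_of_apply_ne B hpr
    have hj : j ≠ 2 := ne_of_apply_ne B hrq.symm
    have hij : i ≠ j := ne_of_apply_ne B hpq
    obtain ⟨rfl, rfl⟩ | ⟨rfl, rfl⟩ : (i = 0 ∧ j = 1) ∨ (i = 1 ∧ j = 0) := by omega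
    · exact hangle
    · rwa [real_inner_comm]

theorem IsAcute.localTriangle_eq_indicator (hΔ : IsAcute Δ) (hT : IsTriangle Δ) :
    localTriangle Δ = (convexHull ℝ (Δ : Set Plane)).indicator
      fun x => Metric.infDist x (Δ : Set Plane) ^ 2 := by
  funext x
  by_cases hx : x ∈ convexHull ℝ (Δ : Set Plane)
  · rw [Set.indicator_of_mem hx, localTriangle_of_mem_hull hx]
  · rw [Set.indicator_of_notMem hx, hT.localTriangle_eq_zero hx fun _ => hΔ.not_hidesVertex]

theorem IsTriangle.integrable_localTriangle (hT : IsTriangle Δ) :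
    Integrable (localTriangle Δ) := by
  by_cases hΔ : IsAcute Δ
  · have hcompact := Δ.finite_toSet.isCompact_convexHull ℝ
    have hcont : Continuous fun x : Plane => Metric.infDist x (Δ : Set Plane) ^ 2 :=
      (Metric.continuous_infDist_pt _).pow 2
    rw [hΔ.localTriangle_eq_indicator hT, integrable_indicator_iff hcompact.measurableSet]
    exact hcont.continuousOn.integrableOn_compact hcompact
  · obtain ⟨B, hB, o, ho⟩ := hT.exists_isObtuseCircumcenter hΔ
    exact ho.integrable_localTriangle hT hB

theorem IsTriangle.integral_localTriangle (hT : IsTriangle Δ) :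
    ∫ x, localTriangle Δ x = triangleVoronoi Δ := by
  by_cases hΔ : IsAcute Δ
  · rw [triangleVoronoi, if_pos hΔ, hΔ.localTriangle_eq_indicator hT, integral_indicator
      (Δ.finite_toSet.isCompact_convexHull ℝ).measurableSet]
  · obtain ⟨B, hB, o, ho⟩ := hT.exists_isObtuseCircumcenter hΔ
    rw [triangleVoronoi, if_neg hΔ, ho.integral_localTriangle hT hB]

variable {S : Finset Plane} {F : Finset (Finset Plane)} {K : Geometry.SimplicialComplex ℝ Plane}

theorem integrable_localVoronoi (hF : ∀ Δ ∈ F, IsTriangle Δ) : Integrable (localVoronoi F) :=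
  integrable_finsetSum F fun Δ hΔ => (hF Δ hΔ).integrable_localTriangle

theorem integral_localVoronoi (hF : ∀ Δ ∈ F, IsTriangle Δ) :
    ∫ x, localVoronoi F x = voronoi F := by
  simp only [localVoronoi, voronoi]
  rw [integral_finsetSum F fun Δ hΔ => (hF Δ hΔ).integrable_localTriangle]
  exact Finset.sum_congr rfl fun Δ hΔ => (hF Δ hΔ).integral_localTriangle

theorem mem_lineUnion_of_mem_hull_of_mem_hull {T T' : Finset Plane} {x : Plane}
    (hT : T ∈ triangles S K) (hT' : T' ∈ triangles S K) (hne : T ≠ T')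
    (hx : x ∈ convexHull ℝ (T : Set Plane)) (hx' : x ∈ convexHull ℝ (T' : Set Plane)) :
    x ∈ lineUnion S := by
  classical
  obtain ⟨⟨hTS, hcard⟩, hTK⟩ := mem_triangles.1 hT
  obtain ⟨⟨-, hcard'⟩, hTK'⟩ := mem_triangles.1 hT'
  have hinter := K.inter_subset_convexHull hTK hTK' ⟨hx, hx'⟩
  rw [← Finset.coe_inter] at hinter
  refine hull_subset_lineUnion (Finset.inter_subset_left.trans hTS) ?_ hinter
  by_contra! hlt
  have hsub : T ⊆ T' := Finset.inter_eq_left.1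
    (Finset.eq_of_subset_of_card_le Finset.inter_subset_left (by omega))
  exact hne (Finset.eq_of_subset_of_card_le hsub (by omega))

theorem voronoi_le (hS : GeneralPosition S) (hK : IsGeometricTriangulation S K) :
    voronoi (triangles S K) ≤ voronoi (delaunay S) := by
  have hK_tri (T) (hT : T ∈ triangles S K) : IsTriangle T := isTriangle_of_mem_triangles hT
  have hD_tri (T) (hT : T ∈ delaunay S) : IsTriangle T := isTriangle_of_mem_delaunay hT
  rw [← integral_localVoronoi hK_tri, ← integral_localVoronoi hD_tri]
  refine integral_mono_ae (integrable_localVoronoi hK_tri) (integrable_localVoronoi hD_tri) ?_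
  filter_upwards [measure_eq_zero_iff_ae_notMem.1 (volume_lineUnion S)] with x hx
  exact localVoronoi_le hS hK fun T hT T' hT' hne h h' =>
    (hx (mem_lineUnion_of_mem_hull_of_mem_hull hT hT' hne h h')).elim

end Integral

end VoronoiFunctional

end

open VoronoiFunctional in
theorem mainTheorem1 (S : Finset Plane) (hS : GeneralPosition S)
    (K : Geometry.SimplicialComplex ℝ Plane) (hK : IsGeometricTriangulation S K) :
    voronoi (triangles S K) ≤ voronoi (delaunay S) ∧
    ∀ x : Plane,
      (∀ Δ ∈ triangles S K, ∀ Δ' ∈ triangles S K, Δ ≠ Δ' →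
        x ∈ convexHull ℝ (Δ : Set Plane) → x ∈ convexHull ℝ (Δ' : Set Plane) → x ∈ S) →
      localVoronoi (triangles S K) x ≤ localVoronoi (delaunay S) x := by
  exact ⟨voronoi_le hS hK, fun _ hx => localVoronoi_le hS hK hx⟩
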